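/- Let $n\ge 2$. Let $\mathfrak g=\mathfrak{psl}_{n|n}$ be the complex Lie superalgebra of $2n\times 2n$ supermatrices (indices $1,\dots,n$ even, $n+1,\dots,2n$ odd) of supertrace zero modulo the scalar matrices, with the supercommutator and the invariant form $(X,Y)=\mathrm{str}(XY)$. For $i\neq j$ let $E^{i,j}\in\mathfrak g$ be the class of the elementary matrix with a $1$ in position $(i,j)$, and let $\mathfrak n_+=\mathrm{span}\{E^{i,j}: 1\le i<j\le 2n\}$. Let $\widehat{\mathfrak g}=\mathfrak g(\!(t)\!)\oplus\mathbb C K\oplus\mathbb C T$ be the affine Lie superalgebra, with $K$ central, $$[x f,\,y g]=[x,y]\,fg+(x,y)\,\mathrm{Res}_{t=0}(f'g)\,K,\qquad [T,xf]=-x f'\qquad (x,y\in\mathfrak g,\ f,g\in\mathbb C(\!(t)\!)),$$ and let $\widehat{\mathfrak n}_+=\mathfrak n_+\oplus t\,\mathfrak g[\![t]\!]$. Let $V^1(\mathfrak{psl}_{n|n})$ be the universal affine vertex algebra of level $1$, i.e. the $\widehat{\mathfrak g}$-module induced from the one-dimensional module over $\mathfrak g[\![t]\!]\oplus\mathbb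 C K\oplus\mathbb C T$ on which $K$ acts as $1$ and $\mathfrak g[\![t]\!]$ and $T$ act as $0$. Write $|0\rangle$ for its vacuum vector, and $x_{(m)}$ for the action of $x t^m$, $x\in\mathfrak g$, $m\in\mathbb Z$; the element $T$ acts as the translation operator. Then the vector $$\chi=E^{1,2n-1}_{(-1)}E^{1,2n}_{(-1)}|0\rangle\in V^1(\mathfrak{psl}_{n|n})$$ is singular, i.e. $p\cdot\chi=0$ for every $p\in\widehat{\mathfrak n}_+$, and the submodule $U=\langle\chi\rangle$ of $V^1(\mathfrak{psl}_{n|n})$ that it generates is proper and non-zero. -/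

import Mathlib

open scoped TensorProduct

noncomputable section

/-! ### Lie superalgebras over the complex numbers -/

/-- The sign `(-1)^(ab)` for parities `a`, `b`. -/
def superSign (a b : ZMod 2) : ℂ := if a = 1 ∧ b = 1 then -1 else 1

/-- A Lie superalgebra structure on a complex vector space `L`: a decomposition
`L = part 0 ⊕ part 1` into an even and an odd part, and an even bilinear bracket that is
super-antisymmetric and satisfies the super Jacobi identity. -/
structure LieSuper (L : Type) [AddCommGroup L] [Module ℂ L] where
  part : ZMod 2 → Submodule ℂ L
  isCompl : IsCompl (part 0) (part 1)
  br : L →ₗ[ℂ] L →ₗ[ℂ] L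
  br_mem : ∀ a b : ZMod 2, ∀ x ∈ part a, ∀ y ∈ part b, br x y ∈ part (a + b)
  skew : ∀ a b : ZMod 2, ∀ x ∈ part a, ∀ y ∈ part b, br x y = -(superSign a b • br y x)
  jacobi : ∀ a b c : ZMod 2, ∀ x ∈ part a, ∀ y ∈ part b, ∀ z ∈ part c,
    br x (br y z) = br (br x y) z + superSign a b • br y (br x z)

/-- An even, supersymmetric, invariant bilinear form on a Lie superalgebra. -/
structure LieSuper.InvForm {L : Type} [AddCommGroup L] [Module ℂ L] (S : LieSuper L) where
  form : L →ₗ[ℂ] L →ₗ[ℂ] ℂ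
  even : ∀ a b : ZMod 2, a ≠ b → ∀ x ∈ S.part a, ∀ y ∈ S.part b, form x y = 0
  symm : ∀ a b : ZMod 2, ∀ x ∈ S.part a, ∀ y ∈ S.part b, form x y = superSign a b • form y x
  inv : ∀ x y z : L, form (S.br x y) z = form x (S.br y z)

namespace LieSuper

variable {L : Type} [AddCommGroup L] [Module ℂ L]

/-- A graded subspace closed under the bracket is a Lie superalgebra. -/
def sub (S : LieSuper L) (W : Submodule ℂ L)
    (hgr : ∀ w ∈ W, ∃ u ∈ W, ∃ v ∈ W, u ∈ S.part 0 ∧ v ∈ S.part 1 ∧ w = u + v)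
    (hbr : ∀ x ∈ W, ∀ y ∈ W, S.br x y ∈ W) : LieSuper W where
  part a := (S.part a).comap W.subtype
  isCompl := by
    constructor
    · rw [Submodule.disjoint_def]
      intro x h0 h1
      exact Subtype.ext (Submodule.disjoint_def.1 S.isCompl.disjoint _ h0 h1)
    · rw [codisjoint_iff, eq_top_iff]
      rintro ⟨w, hw⟩ -
      obtain ⟨u, hu, v, hv, h0, h1, rfl⟩ := hgr w hw
      exact Submodule.mem_sup.2 ⟨⟨u, hu⟩, h0, ⟨v, hv⟩, h1, rfl⟩
  br := LinearMap.mk₂ ℂ (fun x y => ⟨S.br x y, hbr x x.2 y y.2⟩)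
    (fun x x' y => by ext; simp) (fun c x y => by ext; simp)
    (fun x y y' => by ext; simp) (fun c x y => by ext; simp)
  br_mem a b x hx y hy := S.br_mem a b _ hx _ hy
  skew a b x hx y hy := Subtype.ext (S.skew a b _ hx _ hy)
  jacobi a b c x hx y hy z hz := Subtype.ext (S.jacobi a b c _ hx _ hy _ hz)

/-- The quotient of a Lie superalgebra by a central subspace of its even part. -/
def quotCentral (S : LieSuper L) (I : Submodule ℂ L) (hev : I ≤ S.part 0)
    (hl : ∀ x ∈ I, ∀ y, S.br x y = 0) (hr : ∀ x ∈ I, ∀ y, S.br y x = 0) : LieSuper (L ⧸ I) where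
  part a := (S.part a).map I.mkQ
  isCompl := by
    constructor
    · rw [Submodule.disjoint_def]
      rintro _ ⟨u, hu, rfl⟩ ⟨v, hv, huv⟩
      have h1 : v - u ∈ I := (Submodule.Quotient.eq I).1 huv
      have h2 : v ∈ S.part 0 := by simpa using add_mem (hev h1) hu
      have h3 : v = 0 := Submodule.disjoint_def.1 S.isCompl.disjoint _ h2 hv
      rw [← huv, h3, map_zero]
    · rw [codisjoint_iff, ← Submodule.map_sup, S.isCompl.sup_eq_top, Submodule.map_top,
        Submodule.range_mkQ]
  br := I.liftQ
    { toFun := fun x => I.liftQ (I.mkQ ∘ₗ S.br x) (fun y hy => by simp [hr y hy x])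
      map_add' := fun x y => by ext; simp
      map_smul' := fun c x => by ext; simp }
    (fun x hx => by
      rw [LinearMap.mem_ker]
      ext y
      simp [hl x hx y])
  br_mem := by
    rintro a b _ ⟨x, hx, rfl⟩ _ ⟨y, hy, rfl⟩
    exact ⟨_, S.br_mem a b x hx y hy, rfl⟩
  skew := by
    rintro a b _ ⟨x, hx, rfl⟩ _ ⟨y, hy, rfl⟩
    exact congrArg I.mkQ (S.skew a b x hx y hy)
  jacobi := by
    rintro a b c _ ⟨x, hx, rfl⟩ _ ⟨y, hy, rfl⟩ _ ⟨z, hz, rfl⟩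
    exact congrArg I.mkQ (S.jacobi a b c x hx y hy z hz)

end LieSuper

/-! ### The Lie superalgebras `gl(n|n)`, `sl(n|n)` and `psl(n|n)` -/

/-- Square matrices of size `2n`, regarded as endomorphisms of `ℂ^(n|n)`. The rows and columns
`1, …, 2n` of the usual notation are numbered `0, …, 2n - 1` here. -/
abbrev SuperMat (n : ℕ) : Type := Matrix (Fin (2 * n)) (Fin (2 * n)) ℂ

/-- The first `n` indices are even, the last `n` are odd. -/
def idxParity (n : ℕ) (i : Fin (2 * n)) : ZMod 2 := if i.val < n then 0 else 1

/-- The component of parity `a` of a supermatrix: the two diagonal blocks for `a = 0`, the two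
off-diagonal blocks for `a = 1`. -/
def blockProj (n : ℕ) (a : ZMod 2) : SuperMat n →ₗ[ℂ] SuperMat n where
  toFun X := Matrix.of fun i j => if idxParity n i + idxParity n j = a then X i j else 0
  map_add' X Y := by ext i j; simp only [Matrix.of_apply, Matrix.add_apply]; split_ifs <;> simp
  map_smul' c X := by ext i j; simp

/-- The supermatrices of parity `a`. -/
def glPart (n : ℕ) (a : ZMod 2) : Submodule ℂ (SuperMat n) := LinearMap.range (blockProj n a)

/-- The supercommutator `[X, Y] = ∑_{a,b} (X_a Y_b - (-1)^(ab) Y_b X_a)`. -/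
def superComm (n : ℕ) : SuperMat n →ₗ[ℂ] SuperMat n →ₗ[ℂ] SuperMat n :=
  ∑ a : ZMod 2, ∑ b : ZMod 2,
    ((LinearMap.mul ℂ (SuperMat n)).compl₁₂ (blockProj n a) (blockProj n b) -
      superSign a b • (LinearMap.mul ℂ (SuperMat n)).flip.compl₁₂ (blockProj n a) (blockProj n b))

/-- The supertrace. -/
def superTrace (n : ℕ) : SuperMat n →ₗ[ℂ] ℂ where
  toFun X := ∑ i, if idxParity n i = 0 then X i i else -X i i
  map_add' X Y := by
    rw [← Finset.sum_add_distrib]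
    refine Finset.sum_congr rfl fun i _ => ?_
    split_ifs <;> simp [add_comm]
  map_smul' c X := by
    simp only [RingHom.id_apply, smul_eq_mul, Finset.mul_sum]
    refine Finset.sum_congr rfl fun i _ => ?_
    split_ifs <;> simp

theorem zmod2_cases (a : ZMod 2) : a = 0 ∨ a = 1 := by revert a; decide

theorem zmod2_aux1 : ∀ a b c : ZMod 2, a + b + c = 0 → a + c = b := by decide

theorem zmod2_aux2 : ∀ a b : ZMod 2, a ≠ b → a + b = 1 := by decide

theorem zmod2_aux3 : ∀ a : ZMod 2, a + a = 0 := by decide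

theorem blockProj_blockProj (n : ℕ) (a b : ZMod 2) (X : SuperMat n) :
    blockProj n a (blockProj n b X) = if a = b then blockProj n a X else 0 := by
  ext i j
  by_cases h : a = b
  · subst h
    simp only [blockProj, LinearMap.coe_mk, AddHom.coe_mk, Matrix.of_apply, if_true]
    split_ifs <;> rfl
  · rw [if_neg h]
    simp only [blockProj, LinearMap.coe_mk, AddHom.coe_mk, Matrix.of_apply, Matrix.zero_apply]
    split_ifs with h1 h2
    · exact absurd (h1.symm.trans h2) h
    · rfl
    · rfl

theorem blockProj_add (n : ℕ) (X : SuperMat n) : blockProj n 0 X + blockProj n 1 X = X := by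
  ext i j
  simp only [blockProj, LinearMap.coe_mk, AddHom.coe_mk, Matrix.of_apply, Matrix.add_apply]
  rcases zmod2_cases (idxParity n i + idxParity n j) with h | h <;> simp [h]

theorem blockProj_of_mem {n : ℕ} {b : ZMod 2} {X : SuperMat n} (h : X ∈ glPart n b) (a : ZMod 2) :
    blockProj n a X = if a = b then X else 0 := by
  obtain ⟨Y, rfl⟩ := h
  rw [blockProj_blockProj]
  split_ifs with h1
  · rw [h1]
  · rfl

theorem superComm_apply {n : ℕ} {a b : ZMod 2} {X Y : SuperMat n} (hX : X ∈ glPart n a)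
    (hY : Y ∈ glPart n b) : superComm n X Y = X * Y - superSign a b • (Y * X) := by
  have key : superComm n X Y = ∑ c : ZMod 2, ∑ d : ZMod 2,
      (blockProj n c X * blockProj n d Y - superSign c d • (blockProj n d Y * blockProj n c X)) := by
    simp [superComm, LinearMap.sum_apply]
  rw [key]
  simp only [blockProj_of_mem hX, blockProj_of_mem hY]
  rw [Finset.sum_eq_single a, Finset.sum_eq_single b]
  · simp
  · intro d _ hd; simp [hd]
  · simp
  · intro c _ hc; simp [hc]
  · simp

theorem mul_mem_glPart {n : ℕ} {a b : ZMod 2} {X Y : SuperMat n} (hX : X ∈ glPart n a)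
    (hY : Y ∈ glPart n b) : X * Y ∈ glPart n (a + b) := by
  refine ⟨X * Y, ?_⟩
  have hX' := blockProj_of_mem hX a
  have hY' := blockProj_of_mem hY b
  rw [if_pos rfl] at hX' hY'
  have h0 : ∀ p q r s t : ZMod 2, p + q ≠ s + t → p + r = s → r + q = t → False := by decide
  ext i j
  simp only [blockProj, LinearMap.coe_mk, AddHom.coe_mk, Matrix.of_apply]
  split_ifs with h
  · rfl
  · rw [Matrix.mul_apply, eq_comm]
    refine Finset.sum_eq_zero fun k _ => ?_
    rw [← hX', ← hY']
    simp only [blockProj, LinearMap.coe_mk, AddHom.coe_mk, Matrix.of_apply]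
    split_ifs with h1 h2
    · exact (h0 _ _ _ _ _ h h1 h2).elim
    all_goals simp

theorem superSign_comm (a b : ZMod 2) : superSign a b = superSign b a := by
  simp [superSign, and_comm]

/-- The Lie superalgebra `gl(n|n)`. -/
def gl (n : ℕ) : LieSuper (SuperMat n) where
  part := glPart n
  isCompl := by
    constructor
    · rw [Submodule.disjoint_def]
      intro X h0 h1
      have e0 := blockProj_of_mem h0 0
      have e1 := blockProj_of_mem h1 0
      rw [if_pos rfl] at e0
      rw [if_neg (by decide)] at e1
      rw [← e0, e1]
    · rw [codisjoint_iff, eq_top_iff]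
      intro X _
      exact Submodule.mem_sup.2 ⟨_, ⟨X, rfl⟩, _, ⟨X, rfl⟩, blockProj_add n X⟩
  br := superComm n
  br_mem a b X hX Y hY := by
    rw [superComm_apply hX hY]
    refine sub_mem (mul_mem_glPart hX hY) (Submodule.smul_mem _ _ ?_)
    rw [add_comm]
    exact mul_mem_glPart hY hX
  skew a b X hX Y hY := by
    rw [superComm_apply hX hY, superComm_apply hY hX]
    rcases zmod2_cases a with rfl | rfl <;> rcases zmod2_cases b with rfl | rfl <;>
      simp [superSign, add_comm]
  jacobi a b c X hX Y hY Z hZ := by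
    have hbr : ∀ a b : ZMod 2, ∀ X ∈ glPart n a, ∀ Y ∈ glPart n b,
        X * Y - superSign a b • (Y * X) ∈ glPart n (a + b) := by
      intro a b X hX Y hY
      refine sub_mem (mul_mem_glPart hX hY) (Submodule.smul_mem _ _ ?_)
      rw [add_comm]
      exact mul_mem_glPart hY hX
    rw [superComm_apply hY hZ, superComm_apply hX hY, superComm_apply hX hZ,
      superComm_apply hX (hbr _ _ _ hY _ hZ), superComm_apply (hbr _ _ _ hX _ hY) hZ,
      superComm_apply hY (hbr _ _ _ hX _ hZ)]
    have h11 : (1 : ZMod 2) + 1 = 0 := by decide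
    rcases zmod2_cases a with rfl | rfl <;> rcases zmod2_cases b with rfl | rfl <;>
      rcases zmod2_cases c with rfl | rfl <;>
      simp [superSign, h11, mul_add, add_mul, mul_sub, sub_mul, mul_assoc] <;> abel

theorem superTrace_mul_comm {n : ℕ} {a b : ZMod 2} {X Y : SuperMat n} (hX : X ∈ glPart n a)
    (hY : Y ∈ glPart n b) : superTrace n (X * Y) = superSign a b • superTrace n (Y * X) := by
  have hX' := blockProj_of_mem hX a
  have hY' := blockProj_of_mem hY b
  rw [if_pos rfl] at hX' hY'
  have e : ∀ A B : SuperMat n, superTrace n (A * B) =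
      ∑ i, ∑ k, (if idxParity n i = 0 then A i k * B k i else -(A i k * B k i)) := by
    intro A B
    simp only [superTrace, LinearMap.coe_mk, AddHom.coe_mk, Matrix.mul_apply]
    refine Finset.sum_congr rfl fun i _ => ?_
    split_ifs <;> simp
  rw [e, e, Finset.sum_comm, smul_eq_mul, Finset.mul_sum]
  refine Finset.sum_congr rfl fun i _ => ?_
  rw [Finset.mul_sum]
  refine Finset.sum_congr rfl fun k _ => ?_
  rw [← hX', ← hY']
  simp only [blockProj, LinearMap.coe_mk, AddHom.coe_mk, Matrix.of_apply]
  generalize X k i = u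
  generalize Y i k = v
  rcases zmod2_cases (idxParity n i) with hi | hi <;>
    rcases zmod2_cases (idxParity n k) with hk | hk <;>
    rcases zmod2_cases a with rfl | rfl <;> rcases zmod2_cases b with rfl | rfl <;>
    simp [hi, hk, superSign, mul_comm, show (1 : ZMod 2) + 1 = 0 by decide]

theorem superTrace_glPart_one {n : ℕ} {X : SuperMat n} (hX : X ∈ glPart n 1) :
    superTrace n X = 0 := by
  have hX' := blockProj_of_mem hX 1
  rw [if_pos rfl] at hX'
  rw [← hX']
  simp only [superTrace, LinearMap.coe_mk, AddHom.coe_mk]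
  refine Finset.sum_eq_zero fun i _ => ?_
  have : idxParity n i + idxParity n i ≠ 1 := by
    generalize idxParity n i = p
    revert p; decide
  simp [blockProj, this]

theorem superTrace_superComm (n : ℕ) (X Y : SuperMat n) : superTrace n (superComm n X Y) = 0 := by
  have h : ∀ a b : ZMod 2, superTrace n (superComm n (blockProj n a X) (blockProj n b Y)) = 0 := by
    intro a b
    have ha : blockProj n a X ∈ glPart n a := ⟨X, rfl⟩
    have hb : blockProj n b Y ∈ glPart n b := ⟨Y, rfl⟩
    rw [superComm_apply ha hb, map_sub, map_smul, superTrace_mul_comm ha hb, sub_self]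
  have hX := blockProj_add n X
  have hY := blockProj_add n Y
  calc superTrace n (superComm n X Y)
      = superTrace n (superComm n (blockProj n 0 X + blockProj n 1 X)
          (blockProj n 0 Y + blockProj n 1 Y)) := by rw [hX, hY]
    _ = 0 := by simp [h]

theorem superTrace_one (n : ℕ) : superTrace n 1 = 0 := by
  have h1 : superTrace n 1 =
      ∑ i ∈ Finset.range (2 * n), (if i < n then (1 : ℂ) else -1) := by
    rw [Finset.sum_range]
    simp only [superTrace, LinearMap.coe_mk, AddHom.coe_mk, Matrix.one_apply_eq]
    refine Finset.sum_congr rfl fun i _ => ?_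
    by_cases h : i.val < n <;> simp [idxParity, h]
  rw [h1, two_mul, Finset.sum_range_add, Finset.sum_congr rfl
    (fun i hi => if_pos (Finset.mem_range.1 hi))]
  simp

theorem one_mem_glPart (n : ℕ) : (1 : SuperMat n) ∈ glPart n 0 := by
  refine ⟨1, ?_⟩
  ext i j
  by_cases h : i = j
  · subst h
    have : idxParity n i + idxParity n i = 0 := by
      generalize idxParity n i = p
      revert p; decide
    simp [blockProj, this]
  · simp [blockProj, h]

/-- The supermatrices of supertrace zero. -/
def slSpace (n : ℕ) : Submodule ℂ (SuperMat n) := LinearMap.ker (superTrace n)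

/-- The Lie superalgebra `sl(n|n)`. -/
def sl (n : ℕ) : LieSuper (slSpace n) :=
  (gl n).sub (slSpace n)
    (fun w hw => by
      have h1 : blockProj n 1 w ∈ slSpace n := superTrace_glPart_one ⟨w, rfl⟩
      have h0 : blockProj n 0 w ∈ slSpace n := by
        have : blockProj n 0 w = w - blockProj n 1 w := by
          rw [eq_sub_iff_add_eq, blockProj_add]
        rw [this]
        exact sub_mem hw h1
      exact ⟨_, h0, _, h1, ⟨w, rfl⟩, ⟨w, rfl⟩, (blockProj_add n w).symm⟩)
    (fun X _ Y _ => superTrace_superComm n X Y)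

/-- The line of scalar matrices in `sl(n|n)`. -/
def scalarLine (n : ℕ) : Submodule ℂ (slSpace n) :=
  Submodule.span ℂ {⟨1, superTrace_one n⟩}

theorem superComm_one_left (n : ℕ) (Y : SuperMat n) : superComm n 1 Y = 0 := by
  have h : ∀ b : ZMod 2, superComm n 1 (blockProj n b Y) = 0 := by
    intro b
    rw [superComm_apply (one_mem_glPart n) (⟨Y, rfl⟩ : blockProj n b Y ∈ glPart n b)]
    simp [superSign]
  rw [← blockProj_add n Y, map_add, h, h, add_zero]

theorem superComm_one_right (n : ℕ) (Y : SuperMat n) : superComm n Y 1 = 0 := by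
  have h : ∀ b : ZMod 2, superComm n (blockProj n b Y) 1 = 0 := by
    intro b
    rw [superComm_apply (⟨Y, rfl⟩ : blockProj n b Y ∈ glPart n b) (one_mem_glPart n)]
    simp [superSign]
  rw [← blockProj_add n Y, map_add, LinearMap.add_apply, h, h, add_zero]

/-- The underlying vector space of `psl(n|n)`: supermatrices of supertrace zero modulo scalars. -/
abbrev PslSpace (n : ℕ) : Type := slSpace n ⧸ scalarLine n

/-- The Lie superalgebra `psl(n|n)`. -/
def psl (n : ℕ) : LieSuper (PslSpace n) :=
  (sl n).quotCentral (scalarLine n)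
    (by
      rw [scalarLine, Submodule.span_singleton_le_iff_mem]
      exact one_mem_glPart n)
    (fun x hx y => by
      obtain ⟨c, rfl⟩ := Submodule.mem_span_singleton.1 hx
      rw [map_smul, LinearMap.smul_apply]
      have : (sl n).br ⟨1, superTrace_one n⟩ y = 0 := Subtype.ext (superComm_one_left n y)
      rw [this, smul_zero])
    (fun x hx y => by
      obtain ⟨c, rfl⟩ := Submodule.mem_span_singleton.1 hx
      rw [map_smul]
      have : (sl n).br y ⟨1, superTrace_one n⟩ = 0 := Subtype.ext (superComm_one_right n y)
      rw [this, smul_zero])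

/-- The bilinear form `str(XY)` on `sl(n|n)`. -/
def slStrForm (n : ℕ) : slSpace n →ₗ[ℂ] slSpace n →ₗ[ℂ] ℂ :=
  ((LinearMap.mul ℂ (SuperMat n)).compr₂ (superTrace n)).compl₁₂
    (slSpace n).subtype (slSpace n).subtype

/-- The bilinear form `str(XY)` on `psl(n|n)`. -/
def pslStrForm (n : ℕ) : PslSpace n →ₗ[ℂ] PslSpace n →ₗ[ℂ] ℂ :=
  (scalarLine n).liftQ
    { toFun := fun x => (scalarLine n).liftQ (slStrForm n x) (fun y hy => by
        obtain ⟨c, rfl⟩ := Submodule.mem_span_singleton.1 hy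
        have : superTrace n x.1 = 0 := x.2
        simp [slStrForm, this])
      map_add' := fun x y => by ext; simp
      map_smul' := fun c x => by ext; simp }
    (fun x hx => by
      obtain ⟨c, rfl⟩ := Submodule.mem_span_singleton.1 hx
      rw [LinearMap.mem_ker]
      ext y
      have : superTrace n y.1 = 0 := y.2
      simp [slStrForm, this])

theorem superTrace_inv (n : ℕ) (X Y Z : SuperMat n) :
    superTrace n (superComm n X Y * Z) = superTrace n (X * superComm n Y Z) := by
  have h : ∀ a b c : ZMod 2, ∀ X ∈ glPart n a, ∀ Y ∈ glPart n b, ∀ Z ∈ glPart n c,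
      superTrace n (superComm n X Y * Z) = superTrace n (X * superComm n Y Z) := by
    intro a b c X hX Y hY Z hZ
    rw [superComm_apply hX hY, superComm_apply hY hZ]
    have h1 := superTrace_mul_comm hY (mul_mem_glPart hX hZ)
    have h2 := superTrace_mul_comm hX (mul_mem_glPart hZ hY)
    simp only [sub_mul, mul_sub, map_sub, map_smul, Matrix.smul_mul, Matrix.mul_smul, mul_assoc] at *
    by_cases hs : superTrace n (Y * (X * Z)) = 0
    · have : superTrace n (X * (Z * Y)) = 0 := by
        rw [h1] at hs
        rcases smul_eq_zero.1 hs with h | h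
        · exfalso; revert h; unfold superSign; split_ifs <;> simp
        · exact h
      rw [hs, this]; simp
    · have hpar : a + b + c = 0 := by
        rcases zmod2_cases (a + b + c) with h | h
        · exact h
        · exfalso
          apply hs
          have := mul_mem_glPart hY (mul_mem_glPart hX hZ)
          rw [show b + (a + c) = 1 by rw [← h]; ring] at this
          exact superTrace_glPart_one this
      rw [h1]
      have : a + c = b := zmod2_aux1 a b c hpar
      rw [this] at *
      rcases zmod2_cases a with rfl | rfl <;> rcases zmod2_cases b with rfl | rfl <;>
        rcases zmod2_cases c with rfl | rfl <;> first
        | (exfalso; revert hpar; decide)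
        | simp [superSign]
  have hX := blockProj_add n X
  have hY := blockProj_add n Y
  have hZ := blockProj_add n Z
  have h' : ∀ a b c : ZMod 2,
      superTrace n (superComm n (blockProj n a X) (blockProj n b Y) * blockProj n c Z) =
      superTrace n (blockProj n a X * superComm n (blockProj n b Y) (blockProj n c Z)) :=
    fun a b c => h a b c _ ⟨X, rfl⟩ _ ⟨Y, rfl⟩ _ ⟨Z, rfl⟩
  rw [← hX, ← hY, ← hZ]
  simp only [map_add, LinearMap.add_apply, add_mul, mul_add, h']

/-- The supertrace form as an invariant form on `psl(n|n)`. -/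
def pslForm (n : ℕ) : (psl n).InvForm where
  form := pslStrForm n
  even := by
    rintro a b hab _ ⟨x, hx, rfl⟩ _ ⟨y, hy, rfl⟩
    have h := mul_mem_glPart (show x.1 ∈ glPart n a from hx) (show y.1 ∈ glPart n b from hy)
    rw [zmod2_aux2 a b hab] at h
    exact superTrace_glPart_one h
  symm := by
    rintro a b _ ⟨x, hx, rfl⟩ _ ⟨y, hy, rfl⟩
    exact superTrace_mul_comm (show x.1 ∈ glPart n a from hx) (show y.1 ∈ glPart n b from hy)
  inv := by
    intro x y z
    obtain ⟨x, rfl⟩ := (scalarLine n).mkQ_surjective x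
    obtain ⟨y, rfl⟩ := (scalarLine n).mkQ_surjective y
    obtain ⟨z, rfl⟩ := (scalarLine n).mkQ_surjective z
    exact superTrace_inv n x y z

theorem single_mem_slSpace {n : ℕ} {i j : Fin (2 * n)} (h : i ≠ j) :
    Matrix.single i j (1 : ℂ) ∈ slSpace n := by
  change superTrace n _ = 0
  simp only [superTrace, LinearMap.coe_mk, AddHom.coe_mk]
  refine Finset.sum_eq_zero fun k _ => ?_
  have : Matrix.single i j (1 : ℂ) k k = 0 := by
    rw [Matrix.single_apply]
    exact if_neg fun hk => h (hk.1.trans hk.2.symm)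
  simp [this]

/-- The class in `psl(n|n)` of the elementary matrix with a `1` in position `(i, j)`, `i ≠ j`. -/
def pslE {n : ℕ} (i j : Fin (2 * n)) (h : i ≠ j) : PslSpace n :=
  (scalarLine n).mkQ ⟨Matrix.single i j 1, single_mem_slSpace h⟩

/-- The positive part `n_+` of `psl(n|n)`, spanned by the `E^{i,j}` with `i < j`. -/
def pslNPlus (n : ℕ) : Submodule ℂ (PslSpace n) :=
  Submodule.span ℂ {x | ∃ (i j : Fin (2 * n)) (h : i < j), x = pslE i j h.ne}

/-! ### Affinization -/

/-- The field `ℂ((t))` of formal Laurent series, as a `ℂ`-algebra. -/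
def LaurC : Type := LaurentSeries ℂ

instance : CommRing LaurC := inferInstanceAs (CommRing (LaurentSeries ℂ))

instance : Algebra ℂ LaurC := (HahnSeries.instAlgebra : Algebra ℂ (HahnSeries ℤ ℂ))

/-- The coefficient of `t^m`. -/
def LaurC.coeff (f : LaurC) (m : ℤ) : ℂ := HahnSeries.coeff (f : LaurentSeries ℂ) m

theorem LaurC.coeff_add (f g : LaurC) (m : ℤ) : (f + g).coeff m = f.coeff m + g.coeff m :=
  HahnSeries.coeff_add ..

theorem LaurC.coeff_smul (c : ℂ) (f : LaurC) (m : ℤ) : (c • f).coeff m = c * f.coeff m :=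
  rfl

/-- The monomial `t^m`. -/
def LaurC.tpow (m : ℤ) : LaurC := (HahnSeries.single m (1 : ℂ) : LaurentSeries ℂ)

/-- The residue of a Laurent series, the coefficient of `t⁻¹`. -/
def laurentRes : LaurC →ₗ[ℂ] ℂ where
  toFun f := f.coeff (-1)
  map_add' f g := LaurC.coeff_add f g _
  map_smul' c f := LaurC.coeff_smul c f _

/-- The derivative `d/dt` on Laurent series. -/
def laurentD : LaurC →ₗ[ℂ] LaurC where
  toFun f := LaurentSeries.derivative ℂ (f : LaurentSeries ℂ)
  map_add' f g := map_add (LaurentSeries.derivative ℂ (V := ℂ)) f g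
  map_smul' c f := map_smul (LaurentSeries.derivative ℂ (V := ℂ)) c f

theorem derivative_coeff_laurent (f : LaurentSeries ℂ) (m : ℤ) :
    (LaurentSeries.derivative ℂ f).coeff m = ((m : ℂ) + 1) * f.coeff (m + 1) := by
  simp

theorem derivative_mul_laurent (f g : LaurentSeries ℂ) :
    LaurentSeries.derivative ℂ (f * g) = LaurentSeries.derivative ℂ f * g + f * LaurentSeries.derivative ℂ g := by
  have hD : ∀ h : LaurentSeries ℂ, (LaurentSeries.derivative ℂ h).support ⊆ (fun i : ℤ => i - 1) '' h.support := by
    intro h i hi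
    refine ⟨i + 1, ?_, by ring⟩
    rw [HahnSeries.mem_support] at hi ⊢
    intro h0
    apply hi
    rw [derivative_coeff_laurent, h0, mul_zero]
  have hmono : Monotone (fun i : ℤ => i - 1) := fun a b h => by simpa using h
  have hpwo : ∀ h : LaurentSeries ℂ, ((fun i : ℤ => i - 1) '' h.support).IsPWO := fun h =>
    h.isPWO_support.image_of_monotone hmono
  ext m
  rw [derivative_coeff_laurent, HahnSeries.coeff_add,
    HahnSeries.coeff_mul_left' (hpwo f) (hD f), HahnSeries.coeff_mul_right' (hpwo g) (hD g),
    HahnSeries.coeff_mul, Finset.mul_sum]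
  have e1 : ∑ ij ∈ Finset.antidiagonal (hpwo f) g.isPWO_support m,
      (LaurentSeries.derivative ℂ f).coeff ij.1 * g.coeff ij.2 =
      ∑ ij ∈ Finset.antidiagonal f.isPWO_support g.isPWO_support (m + 1),
        (ij.1 : ℂ) * (f.coeff ij.1 * g.coeff ij.2) := by
    symm
    refine Finset.sum_bij' (fun ij _ => (ij.1 - 1, ij.2)) (fun ij _ => (ij.1 + 1, ij.2))
      ?_ ?_ ?_ ?_ ?_
    · rintro ⟨i, j⟩ h
      simp only [Finset.mem_antidiagonal] at h ⊢
      exact ⟨⟨i, h.1, rfl⟩, h.2.1, by omega⟩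
    · rintro ⟨i, j⟩ h
      simp only [Finset.mem_antidiagonal] at h ⊢
      obtain ⟨⟨k, hk, hki⟩, h2, h3⟩ := h
      simp only at hki h3
      have : i + 1 = k := by omega
      exact ⟨by rwa [this], h2, by omega⟩
    · rintro ⟨i, j⟩ _; simp
    · rintro ⟨i, j⟩ _; simp
    · rintro ⟨i, j⟩ _
      simp [mul_assoc]
  have e2 : ∑ ij ∈ Finset.antidiagonal f.isPWO_support (hpwo g) m,
      f.coeff ij.1 * (LaurentSeries.derivative ℂ g).coeff ij.2 =
      ∑ ij ∈ Finset.antidiagonal f.isPWO_support g.isPWO_support (m + 1),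
        (ij.2 : ℂ) * (f.coeff ij.1 * g.coeff ij.2) := by
    symm
    refine Finset.sum_bij' (fun ij _ => (ij.1, ij.2 - 1)) (fun ij _ => (ij.1, ij.2 + 1))
      ?_ ?_ ?_ ?_ ?_
    · rintro ⟨i, j⟩ h
      simp only [Finset.mem_antidiagonal] at h ⊢
      exact ⟨h.1, ⟨j, h.2.1, rfl⟩, by omega⟩
    · rintro ⟨i, j⟩ h
      simp only [Finset.mem_antidiagonal] at h ⊢
      obtain ⟨h2, ⟨k, hk, hki⟩, h3⟩ := h
      simp only at hki h3
      have : j + 1 = k := by omega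
      exact ⟨h2, by rwa [this], by omega⟩
    · rintro ⟨i, j⟩ _; simp
    · rintro ⟨i, j⟩ _; simp
    · rintro ⟨i, j⟩ _
      simp
      ring
  rw [e1, e2, ← Finset.sum_add_distrib]
  refine Finset.sum_congr rfl fun ij h => ?_
  rw [← add_mul]
  congr 1
  have := (Finset.mem_antidiagonal.1 h).2.2
  exact_mod_cast this.symm

theorem laurentD_coeff (f : LaurC) (m : ℤ) :
    (laurentD f).coeff m = ((m : ℂ) + 1) * f.coeff (m + 1) :=
  derivative_coeff_laurent f m

theorem laurentD_mul (f g : LaurC) : laurentD (f * g) = laurentD f * g + f * laurentD g :=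
  derivative_mul_laurent f g

theorem laurentRes_D (f : LaurC) : laurentRes (laurentD f) = 0 := by
  change (laurentD f).coeff (-1) = 0
  rw [laurentD_coeff]
  simp

namespace LieSuper

variable {L : Type} [AddCommGroup L] [Module ℂ L]

/-- The bracket `[f ⊗ x, g ⊗ y] = fg ⊗ [x, y]` on `g((t)) = ℂ((t)) ⊗ g`. -/
def loopBr (S : LieSuper L) :
    (LaurC ⊗[ℂ] L) →ₗ[ℂ] (LaurC ⊗[ℂ] L) →ₗ[ℂ] (LaurC ⊗[ℂ] L) :=
  TensorProduct.map₂ ((LinearMap.mul ℂ LaurC)) S.br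

/-- The cocycle `(f ⊗ x, g ⊗ y) ↦ Res(f' g) (x, y)` on `g((t))`; on `x tᵃ, y tᵇ` it takes the
value `a δ_{a+b,0} (x, y)`. -/
def loopCocycle {S : LieSuper L} (B : S.InvForm) :
    (LaurC ⊗[ℂ] L) →ₗ[ℂ] (LaurC ⊗[ℂ] L) →ₗ[ℂ] ℂ :=
  (TensorProduct.map₂
    (((LinearMap.mul ℂ LaurC).compr₂ laurentRes).comp laurentD) B.form).compr₂
    (TensorProduct.lid ℂ ℂ).toLinearMap

/-- The derivation `f ⊗ x ↦ f' ⊗ x` of `g((t))`. -/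
def loopD (L : Type) [AddCommGroup L] [Module ℂ L] : (LaurC ⊗[ℂ] L) →ₗ[ℂ] (LaurC ⊗[ℂ] L) :=
  TensorProduct.map laurentD LinearMap.id

/-- The part of `g((t))` of parity `a`. -/
def loopPart (S : LieSuper L) (a : ZMod 2) : Submodule ℂ (LaurC ⊗[ℂ] L) :=
  Submodule.span ℂ {z | ∃ f : LaurC, ∃ x ∈ S.part a, z = f ⊗ₜ[ℂ] x}

@[simp] theorem loopBr_tmul (S : LieSuper L) (f g : LaurC) (x y : L) :
    S.loopBr (f ⊗ₜ x) (g ⊗ₜ y) = (f * g) ⊗ₜ S.br x y := rfl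

@[simp] theorem loopCocycle_tmul {S : LieSuper L} (B : S.InvForm) (f g : LaurC) (x y : L) :
    loopCocycle B (f ⊗ₜ x) (g ⊗ₜ y) = laurentRes (laurentD f * g) * B.form x y := rfl

@[simp] theorem loopD_tmul (f : LaurC) (x : L) : loopD L (f ⊗ₜ x) = laurentD f ⊗ₜ x := rfl

theorem loopPart_isCompl (S : LieSuper L) : IsCompl (S.loopPart 0) (S.loopPart 1) := by
  constructor
  · rw [Submodule.disjoint_def]
    intro z h0 h1
    let p : L →ₗ[ℂ] L := (S.part 0).subtype ∘ₗ Submodule.projectionOnto _ _ S.isCompl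
    have e0 : LinearMap.lTensor LaurC p z = z := by
      refine Submodule.span_induction (p := fun z _ => LinearMap.lTensor LaurC p z = z)
        ?_ (by simp) ?_ ?_ h0
      · rintro _ ⟨f, x, hx, rfl⟩
        have : p x = x := congrArg Subtype.val
          (Submodule.projectionOnto_apply_left S.isCompl ⟨x, hx⟩)
        simp [this]
      · intro x y _ _ hx hy; rw [map_add, hx, hy]
      · intro c x _ hx; rw [map_smul, hx]
    have e1 : LinearMap.lTensor LaurC p z = 0 := by
      refine Submodule.span_induction (p := fun z _ => LinearMap.lTensor LaurC p z = 0)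
        ?_ (by simp) ?_ ?_ h1
      · rintro _ ⟨f, x, hx, rfl⟩
        have : p x = 0 := congrArg Subtype.val
          ((Submodule.projectionOnto_apply_eq_zero_iff S.isCompl).2 hx)
        simp [this]
      · intro x y _ _ hx hy; rw [map_add, hx, hy, add_zero]
      · intro c x _ hx; rw [map_smul, hx, smul_zero]
    rw [← e0, e1]
  · rw [codisjoint_iff, eq_top_iff]
    intro z _
    induction z with
    | zero => exact zero_mem _
    | add x y hx hy => exact add_mem (hx trivial) (hy trivial)
    | tmul f x =>
      have hx : x ∈ S.part 0 ⊔ S.part 1 := by rw [S.isCompl.sup_eq_top]; trivial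
      obtain ⟨u, hu, v, hv, rfl⟩ := Submodule.mem_sup.1 hx
      rw [TensorProduct.tmul_add]
      exact Submodule.add_mem_sup (Submodule.subset_span ⟨f, u, hu, rfl⟩)
        (Submodule.subset_span ⟨f, v, hv, rfl⟩)

theorem loop_ind {S : LieSuper L} {a : ZMod 2} {P : (LaurC ⊗[ℂ] L) → Prop}
    (ht : ∀ f : LaurC, ∀ x ∈ S.part a, P (f ⊗ₜ x)) (hadd : ∀ x y, P x → P y → P (x + y))
    (hsmul : ∀ (c : ℂ) x, P x → P (c • x)) {z : LaurC ⊗[ℂ] L} (hz : z ∈ S.loopPart a) : P z := by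
  refine Submodule.span_induction (p := fun z _ => P z) ?_ ?_ (fun x y _ _ => hadd x y)
    (fun c x _ => hsmul c x) hz
  · rintro _ ⟨f, x, hx, rfl⟩
    exact ht f x hx
  · have := ht 0 0 (zero_mem _)
    rwa [TensorProduct.tmul_zero] at this

theorem loopBr_mem (S : LieSuper L) (a b : ZMod 2) : ∀ x ∈ S.loopPart a, ∀ y ∈ S.loopPart b,
    S.loopBr x y ∈ S.loopPart (a + b) := by
  intro x hx y hy
  refine loop_ind (P := fun x => S.loopBr x y ∈ S.loopPart (a + b)) ?_ ?_ ?_ hx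
  · intro f x hx
    refine loop_ind (P := fun y => S.loopBr (f ⊗ₜ x) y ∈ S.loopPart (a + b)) ?_ ?_ ?_ hy
    · intro g y hy
      exact Submodule.subset_span ⟨f * g, _, S.br_mem a b x hx y hy, rfl⟩
    · intro x y hx hy; rw [map_add]; exact add_mem hx hy
    · intro c x hx; rw [map_smul]; exact Submodule.smul_mem _ _ hx
  · intro x y hx hy; rw [map_add]; exact add_mem hx hy
  · intro c x hx; rw [map_smul]; exact Submodule.smul_mem _ _ hx

theorem loopD_mem (S : LieSuper L) (a : ZMod 2) : ∀ x ∈ S.loopPart a,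
    loopD L x ∈ S.loopPart a := by
  intro x hx
  refine loop_ind (P := fun x => loopD L x ∈ S.loopPart a) ?_ ?_ ?_ hx
  · intro f x hx; exact Submodule.subset_span ⟨_, x, hx, rfl⟩
  · intro x y hx hy; rw [map_add]; exact add_mem hx hy
  · intro c x hx; rw [map_smul]; exact Submodule.smul_mem _ _ hx

theorem loopBr_skew (S : LieSuper L) (a b : ZMod 2) : ∀ x ∈ S.loopPart a, ∀ y ∈ S.loopPart b,
    S.loopBr x y = -(superSign a b • S.loopBr y x) := by
  intro x hx y hy
  refine loop_ind (P := fun x => S.loopBr x y = -(superSign a b • S.loopBr y x)) ?_ ?_ ?_ hx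
  · intro f x hx
    refine loop_ind (P := fun y => S.loopBr (f ⊗ₜ x) y =
      -(superSign a b • S.loopBr y (f ⊗ₜ x))) ?_ ?_ ?_ hy
    · intro g y hy
      rw [loopBr_tmul, loopBr_tmul, S.skew a b x hx y hy, mul_comm f g, TensorProduct.tmul_neg,
        TensorProduct.tmul_smul]
    · intro x y hx hy
      simp only [map_add, LinearMap.add_apply, hx, hy]; module
    · intro c x hx
      simp only [map_smul, LinearMap.smul_apply, hx]; module
  · intro x y hx hy
    simp only [map_add, LinearMap.add_apply, hx, hy]; module
  · intro c x hx
    simp only [map_smul, LinearMap.smul_apply, hx]; module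

theorem loopBr_jacobi (S : LieSuper L) (a b c : ZMod 2) : ∀ x ∈ S.loopPart a,
    ∀ y ∈ S.loopPart b, ∀ z ∈ S.loopPart c, S.loopBr x (S.loopBr y z) =
      S.loopBr (S.loopBr x y) z + superSign a b • S.loopBr y (S.loopBr x z) := by
  intro x hx y hy z hz
  refine loop_ind (P := fun x => S.loopBr x (S.loopBr y z) =
      S.loopBr (S.loopBr x y) z + superSign a b • S.loopBr y (S.loopBr x z)) ?_ ?_ ?_ hx
  · intro f x hx
    refine loop_ind (P := fun y => S.loopBr (f ⊗ₜ x) (S.loopBr y z) =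
      S.loopBr (S.loopBr (f ⊗ₜ x) y) z + superSign a b • S.loopBr y (S.loopBr (f ⊗ₜ x) z))
      ?_ ?_ ?_ hy
    · intro g y hy
      refine loop_ind (P := fun z => S.loopBr (f ⊗ₜ x) (S.loopBr (g ⊗ₜ y) z) =
        S.loopBr (S.loopBr (f ⊗ₜ x) (g ⊗ₜ y)) z +
          superSign a b • S.loopBr (g ⊗ₜ y) (S.loopBr (f ⊗ₜ x) z)) ?_ ?_ ?_ hz
      · intro h z hz
        simp only [loopBr_tmul]
        rw [S.jacobi a b c x hx y hy z hz, TensorProduct.tmul_add, TensorProduct.tmul_smul,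
          mul_assoc, mul_left_comm g f h]
      · intro x y hx hy
        simp only [map_add, hx, hy]; module
      · intro c x hx
        simp only [map_smul, hx]; module
    · intro x y hx hy
      simp only [map_add, LinearMap.add_apply, hx, hy]; module
    · intro c x hx
      simp only [map_smul, LinearMap.smul_apply, hx]; module
  · intro x y hx hy
    simp only [map_add, LinearMap.add_apply, hx, hy]; module
  · intro c x hx
    simp only [map_smul, LinearMap.smul_apply, hx]; module

theorem loopD_br (S : LieSuper L) (x y : LaurC ⊗[ℂ] L) :
    loopD L (S.loopBr x y) = S.loopBr (loopD L x) y + S.loopBr x (loopD L y) := by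
  induction x with
  | zero => simp
  | add x x' hx hx' => simp only [map_add, LinearMap.add_apply, hx, hx']; abel
  | tmul f x =>
    induction y with
    | zero => simp
    | add y y' hy hy' => simp only [map_add, hy, hy']; abel
    | tmul g y => simp only [loopBr_tmul, loopD_tmul, laurentD_mul, TensorProduct.add_tmul]

theorem loopCocycle_D {S : LieSuper L} (B : S.InvForm) (x y : LaurC ⊗[ℂ] L) :
    loopCocycle B (loopD L x) y + loopCocycle B x (loopD L y) = 0 := by
  induction x with
  | zero => simp
  | add x x' hx hx' =>
    simp only [map_add, LinearMap.add_apply]; linear_combination hx + hx'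
  | tmul f x =>
    induction y with
    | zero => simp
    | add y y' hy hy' => simp only [map_add]; linear_combination hy + hy'
    | tmul g y =>
      simp only [loopCocycle_tmul, loopD_tmul]
      rw [← add_mul, ← map_add, ← laurentD_mul, laurentRes_D, zero_mul]

theorem loopCocycle_even {S : LieSuper L} (B : S.InvForm) (a b : ZMod 2) (hab : a ≠ b) :
    ∀ x ∈ S.loopPart a, ∀ y ∈ S.loopPart b, loopCocycle B x y = 0 := by
  intro x hx y hy
  refine loop_ind (P := fun x => loopCocycle B x y = 0) ?_ ?_ ?_ hx
  · intro f x hx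
    refine loop_ind (P := fun y => loopCocycle B (f ⊗ₜ x) y = 0) ?_ ?_ ?_ hy
    · intro g y hy
      rw [loopCocycle_tmul, B.even a b hab x hx y hy, mul_zero]
    · intro x y hx hy; rw [map_add, hx, hy, add_zero]
    · intro c x hx; rw [map_smul, hx, smul_zero]
  · intro x y hx hy; rw [map_add, LinearMap.add_apply, hx, hy, add_zero]
  · intro c x hx; rw [map_smul, LinearMap.smul_apply, hx, smul_zero]

theorem loopCocycle_skew {S : LieSuper L} (B : S.InvForm) (a b : ZMod 2) :
    ∀ x ∈ S.loopPart a, ∀ y ∈ S.loopPart b,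
    loopCocycle B x y = -(superSign a b • loopCocycle B y x) := by
  intro x hx y hy
  refine loop_ind (P := fun x => loopCocycle B x y = -(superSign a b • loopCocycle B y x))
    ?_ ?_ ?_ hx
  · intro f x hx
    refine loop_ind (P := fun y => loopCocycle B (f ⊗ₜ x) y =
      -(superSign a b • loopCocycle B y (f ⊗ₜ x))) ?_ ?_ ?_ hy
    · intro g y hy
      have h : laurentRes (laurentD f * g) + laurentRes (laurentD g * f) = 0 := by
        rw [mul_comm (laurentD g) f, ← map_add, ← laurentD_mul, laurentRes_D]
      rw [loopCocycle_tmul, loopCocycle_tmul, B.symm a b x hx y hy, smul_eq_mul, smul_eq_mul]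
      linear_combination (superSign a b * B.form y x) * h
    · intro x y hx hy
      simp only [map_add, LinearMap.add_apply, hx, hy]; module
    · intro c x hx
      simp only [map_smul, LinearMap.smul_apply, hx]; module
  · intro x y hx hy
    simp only [map_add, LinearMap.add_apply, hx, hy]; module
  · intro c x hx
    simp only [map_smul, LinearMap.smul_apply, hx]; module

theorem loopCocycle_jacobi {S : LieSuper L} (B : S.InvForm) (a b : ZMod 2) :
    ∀ x ∈ S.loopPart a, ∀ y ∈ S.loopPart b, ∀ z, loopCocycle B x (S.loopBr y z) =
      loopCocycle B (S.loopBr x y) z + superSign a b • loopCocycle B y (S.loopBr x z) := by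
  intro x hx y hy z
  refine loop_ind (P := fun x => loopCocycle B x (S.loopBr y z) =
      loopCocycle B (S.loopBr x y) z + superSign a b • loopCocycle B y (S.loopBr x z))
      ?_ ?_ ?_ hx
  · intro f x hx
    refine loop_ind (P := fun y => loopCocycle B (f ⊗ₜ x) (S.loopBr y z) =
      loopCocycle B (S.loopBr (f ⊗ₜ x) y) z +
        superSign a b • loopCocycle B y (S.loopBr (f ⊗ₜ x) z)) ?_ ?_ ?_ hy
    · intro g y hy
      induction z with
      | zero => simp
      | add z z' hz hz' => simp only [map_add, hz, hz']; module
      | tmul h z =>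
        simp only [loopBr_tmul, loopCocycle_tmul, smul_eq_mul]
        rw [← B.inv x y z, ← B.inv y x z, S.skew a b x hx y hy, laurentD_mul, add_mul, map_add,
          map_neg, map_smul, LinearMap.neg_apply, LinearMap.smul_apply, smul_eq_mul,
          show laurentD f * (g * h) = laurentD f * g * h by ring,
          show laurentD g * (f * h) = f * laurentD g * h by ring]
        ring
    · intro x y hx hy
      simp only [map_add, LinearMap.add_apply, hx, hy]; module
    · intro c x hx
      simp only [map_smul, LinearMap.smul_apply, hx]; module
  · intro x y hx hy
    simp only [map_add, LinearMap.add_apply, hx, hy]; module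
  · intro c x hx
    simp only [map_smul, LinearMap.smul_apply, hx]; module

end LieSuper

/-- The underlying space `g((t)) ⊕ ℂ K ⊕ ℂ T` of the affinization of `g`, with `g((t))` realized
as `ℂ((t)) ⊗ g` (so `g` is meant to be finite-dimensional). -/
abbrev AffSpace (L : Type) [AddCommGroup L] [Module ℂ L] : Type := (LaurC ⊗[ℂ] L) × ℂ × ℂ

namespace LieSuper

variable {L : Type} [AddCommGroup L] [Module ℂ L]

/-- The affine Lie superalgebra `g((t)) ⊕ ℂ K ⊕ ℂ T`. The element `K` is central, and the
bracket of `g((t))` is twisted by the cocycle `Res(f' g) (x, y) K`; the even element `T` acts as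
`-d/dt`: `[T, f ⊗ x] = -f' ⊗ x`. -/
def affine (S : LieSuper L) (B : S.InvForm) : LieSuper (AffSpace L) where
  part a := (S.loopPart a).prod (if a = 0 then ⊤ else ⊥)
  isCompl := by
    constructor
    · rw [Submodule.disjoint_def]
      rintro ⟨x, k⟩ ⟨h0, -⟩ ⟨h1, h2⟩
      have hx := Submodule.disjoint_def.1 S.loopPart_isCompl.disjoint x h0 h1
      have hk : k = 0 := by simpa using h2
      rw [hx, hk]; rfl
    · rw [codisjoint_iff, eq_top_iff]
      rintro ⟨x, k⟩ -
      have hx : x ∈ S.loopPart 0 ⊔ S.loopPart 1 := by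
        rw [S.loopPart_isCompl.sup_eq_top]; trivial
      obtain ⟨u, hu, v, hv, rfl⟩ := Submodule.mem_sup.1 hx
      exact Submodule.mem_sup.2 ⟨(u, k), ⟨hu, by simp⟩, (v, 0), ⟨hv, by simp⟩, by simp⟩
  br := LinearMap.mk₂ ℂ
    (fun p q => (S.loopBr p.1 q.1 - p.2.2 • loopD L q.1 + q.2.2 • loopD L p.1,
      loopCocycle B p.1 q.1, 0))
    (fun p p' q => by
      ext1
      · simp only [Prod.fst_add, Prod.snd_add, map_add, LinearMap.add_apply]; module
      · ext1 <;> simp)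
    (fun c p q => by
      ext1
      · simp only [Prod.smul_fst, Prod.smul_snd, map_smul, LinearMap.smul_apply, smul_eq_mul]
        module
      · ext1 <;> simp)
    (fun p q q' => by
      ext1
      · simp only [Prod.fst_add, Prod.snd_add, map_add]; module
      · ext1 <;> simp)
    (fun c p q => by
      ext1
      · simp only [Prod.smul_fst, Prod.smul_snd, map_smul, smul_eq_mul]
        module
      · ext1 <;> simp)
  br_mem := by
    rintro a b ⟨x, k, s⟩ ⟨hx, hs⟩ ⟨y, l, u⟩ ⟨hy, hu⟩
    refine ⟨add_mem (sub_mem (S.loopBr_mem a b x hx y hy) ?_) ?_, ?_⟩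
    · rcases zmod2_cases a with rfl | rfl
      · rw [zero_add]; exact Submodule.smul_mem _ _ (S.loopD_mem b y hy)
      · have : s = 0 := by
          have : (k, s) = 0 := by simpa using hs
          exact congrArg Prod.snd this
        simp [this]
    · rcases zmod2_cases b with rfl | rfl
      · rw [add_zero]; exact Submodule.smul_mem _ _ (S.loopD_mem a x hx)
      · have : u = 0 := by
          have : (l, u) = 0 := by simpa using hu
          exact congrArg Prod.snd this
        simp [this]
    · by_cases hab : a = b
      · have : a + b = 0 := by subst hab; exact zmod2_aux3 a
        simp [this]
      · simp only [LinearMap.mk₂_apply, loopCocycle_even B a b hab x hx y hy]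
        exact zero_mem _
  skew := by
    rintro a b ⟨x, k, s⟩ ⟨hx, hs⟩ ⟨y, l, u⟩ ⟨hy, hu⟩
    have es : superSign a b * s = s := by
      rcases zmod2_cases a with rfl | rfl
      · simp [superSign]
      · have : (k, s) = 0 := by simpa using hs
        simp [show s = 0 from congrArg Prod.snd this]
    have eu : superSign a b * u = u := by
      rcases zmod2_cases b with rfl | rfl
      · simp [superSign]
      · have : (l, u) = 0 := by simpa using hu
        simp [show u = 0 from congrArg Prod.snd this]
    ext1
    · simp only [LinearMap.mk₂_apply, Prod.fst_neg, Prod.smul_fst]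
      rw [S.loopBr_skew a b x hx y hy, smul_add, smul_sub, smul_smul, smul_smul, es, eu]
      abel
    · ext1
      · simpa using loopCocycle_skew B a b x hx y hy
      · simp
  jacobi := by
    rintro a b c ⟨x, k, s⟩ ⟨hx, hs⟩ ⟨y, l, u⟩ ⟨hy, hu⟩ ⟨z, m, v⟩ ⟨hz, hv⟩
    have es : superSign a b * s = s := by
      rcases zmod2_cases a with rfl | rfl
      · simp [superSign]
      · have : (k, s) = 0 := by simpa using hs
        simp [show s = 0 from congrArg Prod.snd this]
    have eu : superSign a b * u = u := by
      rcases zmod2_cases b with rfl | rfl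
      · simp [superSign]
      · have : (l, u) = 0 := by simpa using hu
        simp [show u = 0 from congrArg Prod.snd this]
    ext1
    · simp only [LinearMap.mk₂_apply, Prod.fst_add, Prod.smul_fst, map_add, map_sub, map_smul,
        LinearMap.add_apply, LinearMap.sub_apply, LinearMap.smul_apply, loopD_br, zero_smul]
      rw [S.loopBr_jacobi a b c x hx y hy z hz]
      have h1 := S.loopBr_skew a b _ (S.loopD_mem a x hx) y hy
      have e1 : superSign a b • S.loopBr y (loopD L x) = -S.loopBr (loopD L x) y := by
        rw [h1, neg_neg]
      have es' : ∀ w : LaurC ⊗[ℂ] L, superSign a b • s • w = s • w := fun w => by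
        rw [smul_smul, es]
      have eu' : ∀ w : LaurC ⊗[ℂ] L, superSign a b • u • w = u • w := fun w => by
        rw [smul_smul, eu]
      simp only [smul_add, smul_sub, smul_zero, es', eu', smul_comm (superSign a b) v, e1]
      module
    · ext1
      · simp only [LinearMap.mk₂_apply, Prod.fst_add, Prod.snd_add, Prod.smul_fst, Prod.smul_snd,
          map_add, map_sub, map_smul, LinearMap.add_apply, LinearMap.sub_apply,
          LinearMap.smul_apply, smul_eq_mul, loopCocycle_jacobi B a b x hx y hy z]
        have h1 := loopCocycle_D B x y
        have h2 := loopCocycle_D B x z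
        have h3 := loopCocycle_D B y z
        have h4 := loopCocycle_skew B a b _ (S.loopD_mem a x hx) y hy
        rw [smul_eq_mul] at h4
        linear_combination v * h1 - u * h2 + s * h3 - v * h4 + (loopCocycle B y (loopD L z)) * es
      · simp

end LieSuper

/-! ### Enveloping algebras and universal affine vertex algebras -/

namespace LieSuper

variable {L : Type} [AddCommGroup L] [Module ℂ L]

/-- The relations `x y = (-1)^(|x||y|) y x + [x, y]` of the universal enveloping algebra, for
homogeneous `x`, `y`. -/
inductive EnvRel (S : LieSuper L) : TensorAlgebra ℂ L → TensorAlgebra ℂ L → Prop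
  | comm (a b : ZMod 2) (x y : L) (hx : x ∈ S.part a) (hy : y ∈ S.part b) :
      EnvRel S (TensorAlgebra.ι ℂ x * TensorAlgebra.ι ℂ y)
        (superSign a b • (TensorAlgebra.ι ℂ y * TensorAlgebra.ι ℂ x) +
          TensorAlgebra.ι ℂ (S.br x y))

/-- The universal enveloping algebra of a Lie superalgebra. -/
abbrev Env (S : LieSuper L) : Type := RingQuot (EnvRel S)

/-- The canonical map from a Lie superalgebra to its enveloping algebra. -/
def envι (S : LieSuper L) : L →ₗ[ℂ] S.Env :=
  (RingQuot.mkAlgHom ℂ (EnvRel S)).toLinearMap ∘ₗ TensorAlgebra.ι ℂ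

end LieSuper

section UniversalAffine

variable {L : Type} [AddCommGroup L] [Module ℂ L]

/-- The subspace `t^N g[[t]]` of `g((t))`. -/
def powerPart (L : Type) [AddCommGroup L] [Module ℂ L] (N : ℤ) : Submodule ℂ (LaurC ⊗[ℂ] L) :=
  Submodule.span ℂ {z | ∃ (f : LaurC) (x : L), (∀ m < N, f.coeff m = 0) ∧ z = f ⊗ₜ[ℂ] x}

/-- The left ideal of `U(ĝ)` generated by the elements `p - λ(p)`, for `p` in the subalgebra
`g[[t]] ⊕ ℂ K ⊕ ℂ T` and `λ` its character with `λ(K) = k`, `λ(g[[t]]) = 0`, `λ(T) = 0`. -/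
def vacuumIdeal (S : LieSuper L) (B : S.InvForm) (k : ℂ) :
    Submodule (S.affine B).Env (S.affine B).Env :=
  Submodule.span (S.affine B).Env
    {u | ∃ p : AffSpace L, p.1 ∈ powerPart L 0 ∧
      u = (S.affine B).envι p - algebraMap ℂ (S.affine B).Env (k * p.2.1)}

/-- The universal affine vertex algebra `V^k(g)` as a `ĝ`-module: the module induced from the
one-dimensional module `ℂ_k` over `g[[t]] ⊕ ℂ K ⊕ ℂ T` on which `K` acts as `k` and the rest
acts by zero. As a module over `g((t)) ⊕ ℂ K` it is the module induced from
`g[[t]] ⊕ ℂ K`, and `T` acts as the translation operator. The mode `x_(m)` of the field `x(z)` of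
`x ∈ g` is the action of `x t^m`. -/
abbrev UnivAffine (S : LieSuper L) (B : S.InvForm) (k : ℂ) : Type :=
  (S.affine B).Env ⧸ vacuumIdeal S B k

/-- The vacuum vector. -/
def vacuum (S : LieSuper L) (B : S.InvForm) (k : ℂ) : UnivAffine S B k :=
  (vacuumIdeal S B k).mkQ 1

/-- The element `x t^m` of `ĝ`, as an element of `U(ĝ)`. -/
def mode (S : LieSuper L) (B : S.InvForm) (x : L) (m : ℤ) : (S.affine B).Env :=
  (S.affine B).envι (LaurC.tpow m ⊗ₜ[ℂ] x, 0, 0)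

/-- The positive part `n_+ ⊕ t g[[t]]` of `ĝ`, for a given positive part `n_+` of `g`. -/
def affNPlus (nplus : Submodule ℂ L) : Submodule ℂ (AffSpace L) :=
  (nplus.map (TensorProduct.mk ℂ LaurC L 1) ⊔ powerPart L 1).map
    (LinearMap.inl ℂ (LaurC ⊗[ℂ] L) (ℂ × ℂ))

/-- A vector of `V^k(g)` is singular if it is annihilated by the positive part of `ĝ`. -/
def IsSingularVector (S : LieSuper L) (B : S.InvForm) (k : ℂ) (nplus : Submodule ℂ L)
    (v : UnivAffine S B k) : Prop :=
  ∀ p ∈ affNPlus nplus, (S.affine B).envι p • v = 0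

end UniversalAffine

/-- The universal affine vertex algebra `V^1(psl(n|n))`. -/
abbrev VPsl (n : ℕ) : Type := UnivAffine (psl n) (pslForm n) 1

/-- The mode `E^{i,j}_(m)`, `i ≠ j`; the indices start at `0`. -/
def modeE {n : ℕ} (i j : Fin (2 * n)) (h : i ≠ j) (m : ℤ) : ((psl n).affine (pslForm n)).Env :=
  mode (psl n) (pslForm n) (pslE i j h) m

/-- The vector `χ = E^{1,2n-1}_(-1) E^{1,2n}_(-1) |0⟩`; in the zero-based numbering, the indices
`1, 2n-1, 2n` are `0, 2n-2, 2n-1`. -/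
def chi (n : ℕ) (hn : 2 ≤ n) : VPsl n :=
  modeE (⟨0, by omega⟩ : Fin (2 * n)) ⟨2 * n - 2, by omega⟩
      (by rw [Ne, Fin.mk.injEq]; omega) (-1) •
    modeE (⟨0, by omega⟩ : Fin (2 * n)) ⟨2 * n - 1, by omega⟩
      (by rw [Ne, Fin.mk.injEq]; omega) (-1) •
    vacuum (psl n) (pslForm n) 1

/-- The submodule of `V^1(psl(n|n))` generated by `χ`. -/
def chiSubmodule (n : ℕ) (hn : 2 ≤ n) :
    Submodule ((psl n).affine (pslForm n)).Env (VPsl n) :=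
  Submodule.span ((psl n).affine (pslForm n)).Env {chi n hn}

end

/-! Write n_- for t⁻¹g[t⁻¹], and let y, z be the classes of the elementary matrices in the first row
and the last two columns; both are odd, with [y,z] = [z,z] = 0.

Singularity is a commutator computation. If f lies in tℂ[[t]], moving x f through y_(-1) z_(-1) to
the vacuum leaves the coefficient of t in f times the (-1)-mode of ±k(x,z)y ± k(x,y)z + [[x,y],z]
(`positive_current_smul`). As matrices YZ = ZY = 0, so only YXZ and ZXY survive in the double
commutator; they are multiples of Z and Y by entries of X, and the same entries compute the
supertrace pairings. At k = 1 everything cancels (`psl_contraction`). An elementary matrix in n_+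
kills z and sends y to a multiple of z, and z_(-1) z_(-1)|0⟩ = 0 because z is odd with [z,z] = 0
(`constant_current_smul`).

The other two claims require knowing that the induced module has not collapsed. In place of a PBW
theorem, an action of ĝ is built directly on U(n_-) (`Splitting.act`), and u|0⟩ ↦ u·1 maps V^k to it
(`univAffineToNeg`). For χ ≠ 0, the functional Res kills brackets in n_-, so two functionals on the
odd part of g yield a representation of U(n_-) on the exterior algebra of a plane, where χ becomes a
non-zero 2 × 2 determinant (`mode_mode_vacuum_ne_zero`). For properness, n_- acts on U(n_-) by left
multiplication, so the augmentation vanishes on n_-V but not on the vacuum. The vector χ lies in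
n_-V and is killed by t g[[t]]; both properties survive the action of g, and n_-, K and T preserve
n_-V. Hence U(ĝ)χ stays inside n_-V (`smul_mem_negImage`). -/

namespace LieSuper

variable {L : Type} [AddCommGroup L] [Module ℂ L]

/-! ### Signs, homogeneous components and the universal property of the enveloping algebra. -/

theorem superSign_mul_self (a b : ZMod 2) : superSign a b * superSign a b = 1 := by
  unfold superSign; split_ifs <;> simp

theorem superSign_add_left (a b c : ZMod 2) :
    superSign (a + b) c = superSign a c * superSign b c := by
  have h11 : (1 : ZMod 2) + 1 = 0 := by decide
  rcases zmod2_cases a with rfl | rfl <;> rcases zmod2_cases b with rfl | rfl <;>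
    rcases zmod2_cases c with rfl | rfl <;> simp [superSign, h11]

theorem superSign_add_right (a b c : ZMod 2) :
    superSign a (b + c) = superSign a b * superSign a c := by
  rw [superSign_comm, superSign_add_left, superSign_comm b, superSign_comm c]

theorem isCompl_part (S : LieSuper L) (a : ZMod 2) : IsCompl (S.part a) (S.part (a + 1)) := by
  rcases zmod2_cases a with rfl | rfl
  · exact S.isCompl
  · exact S.isCompl.symm

/-- The component of parity `a`. -/
noncomputable def proj (S : LieSuper L) (a : ZMod 2) : L →ₗ[ℂ] L :=
  (S.part a).projection (S.part (a + 1)) (S.isCompl_part a)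

theorem proj_mem (S : LieSuper L) (a : ZMod 2) (x : L) : S.proj a x ∈ S.part a :=
  Submodule.projection_apply_mem _ _

theorem proj_of_mem (S : LieSuper L) {a b : ZMod 2} {x : L} (hx : x ∈ S.part b) :
    S.proj a x = if a = b then x else 0 := by
  split_ifs with h
  · subst h
    exact Submodule.projection_apply_left _ ⟨x, hx⟩
  · refine (Submodule.projection_apply_eq_zero_iff _).2 ?_
    have key : ∀ a b : ZMod 2, a ≠ b → a + 1 = b := by decide
    rwa [key a b h]

theorem proj_add_proj (S : LieSuper L) (x : L) : S.proj 0 x + S.proj 1 x = x := by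
  have := Submodule.projection_add_projection_eq_self (S.isCompl_part 0) x
  exact this

/-- Induction over homogeneous elements. -/
theorem homogeneous_induction (S : LieSuper L) {P : L → Prop} (x : L)
    (hom : ∀ a, ∀ x ∈ S.part a, P x) (add : ∀ x y, P x → P y → P (x + y)) : P x := by
  rw [← S.proj_add_proj x]
  exact add _ _ (hom 0 _ (S.proj_mem 0 x)) (hom 1 _ (S.proj_mem 1 x))

theorem envι_mul_envι (S : LieSuper L) {a b : ZMod 2} {x y : L} (hx : x ∈ S.part a)
    (hy : y ∈ S.part b) :
    S.envι x * S.envι y = superSign a b • (S.envι y * S.envι x) + S.envι (S.br x y) := by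
  have h := RingQuot.mkAlgHom_rel ℂ (EnvRel.comm (S := S) a b x y hx hy)
  rw [map_mul, map_add, map_smul, map_mul] at h
  exact h

/-- The universal property of the enveloping algebra. -/
noncomputable def envLift (S : LieSuper L) {A : Type} [Semiring A] [Algebra ℂ A] (f : L →ₗ[ℂ] A)
    (hf : ∀ a b : ZMod 2, ∀ x ∈ S.part a, ∀ y ∈ S.part b,
      f x * f y = superSign a b • (f y * f x) + f (S.br x y)) : S.Env →ₐ[ℂ] A :=
  RingQuot.liftAlgHom ℂ ⟨TensorAlgebra.lift ℂ f, by
    rintro _ _ ⟨a, b, x, y, hx, hy⟩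
    simpa using hf a b x hx y hy⟩

@[simp] theorem envLift_envι (S : LieSuper L) {A : Type} [Semiring A] [Algebra ℂ A] (f : L →ₗ[ℂ] A)
    (hf : ∀ a b : ZMod 2, ∀ x ∈ S.part a, ∀ y ∈ S.part b,
      f x * f y = superSign a b • (f y * f x) + f (S.br x y)) (x : L) :
    S.envLift f hf (S.envι x) = f x := by
  simp [envLift, envι]

theorem env_induction (S : LieSuper L) {P : S.Env → Prop} (u : S.Env) (one : P 1)
    (add : ∀ u v, P u → P v → P (u + v)) (smul : ∀ (c : ℂ) u, P u → P (c • u))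
    (mul : ∀ x u, P u → P (S.envι x * u)) : P u := by
  obtain ⟨w, rfl⟩ := RingQuot.mkAlgHom_surjective ℂ (EnvRel S) u
  -- Strengthened so that products of tensors can be handled: left multiplication by the image of
  -- any tensor preserves `P`.
  suffices h : ∀ v, P v → P (RingQuot.mkAlgHom ℂ (EnvRel S) w * v) by
    simpa using h 1 one
  induction w using TensorAlgebra.induction with
  | algebraMap c =>
    intro v hv
    rw [AlgHom.commutes, ← Algebra.smul_def]
    exact smul c v hv
  | ι x => exact fun v hv => mul x v hv
  | mul x y hx hy =>
    intro v hv
    rw [map_mul, mul_assoc]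
    exact hx _ (hy v hv)
  | add x y hx hy =>
    intro v hv
    rw [map_add, add_mul]
    exact add _ _ (hx v hv) (hy v hv)

/-- For a linear map `ρ : L → A` to an algebra, the endomorphism of `Hom(L, A)` given by
`(y H)(w) = (-1)^(|w||y|) ρ(y) H(w) + H([w, y])`. -/
noncomputable def coadj (S : LieSuper L) {A : Type} [Ring A] [Algebra ℂ A] (ρ : L →ₗ[ℂ] A) :
    L →ₗ[ℂ] Module.End ℂ (L →ₗ[ℂ] A) :=
  LinearMap.mk₂ ℂ
    (fun y H => (∑ a : ZMod 2, ∑ b : ZMod 2, superSign a b •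
      (LinearMap.mulLeft ℂ (ρ (S.proj b y)) ∘ₗ H ∘ₗ S.proj a)) + H ∘ₗ S.br.flip y)
    (fun y y' H => by
      ext w
      simp only [LinearMap.add_apply, LinearMap.sum_apply, LinearMap.smul_apply,
        LinearMap.comp_apply, LinearMap.mulLeft_apply, map_add, add_mul, smul_add,
        Finset.sum_add_distrib]
      abel)
    (fun c y H => by
      ext w
      simp only [LinearMap.add_apply, LinearMap.sum_apply, LinearMap.smul_apply,
        LinearMap.comp_apply, LinearMap.mulLeft_apply, map_smul, smul_mul_assoc, smul_add,
        Finset.smul_sum, smul_comm c])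
    (fun y H H' => by
      ext w
      simp only [LinearMap.add_apply, LinearMap.sum_apply, LinearMap.smul_apply,
        LinearMap.comp_apply, LinearMap.mulLeft_apply, mul_add, smul_add,
        Finset.sum_add_distrib]
      abel)
    (fun c y H => by
      ext w
      simp only [LinearMap.add_apply, LinearMap.sum_apply, LinearMap.smul_apply,
        LinearMap.comp_apply, LinearMap.mulLeft_apply, mul_smul_comm, smul_add,
        Finset.smul_sum, smul_comm c])

theorem coadj_apply (S : LieSuper L) {A : Type} [Ring A] [Algebra ℂ A] (ρ : L →ₗ[ℂ] A)
    {a b : ZMod 2} {w y : L} (hw : w ∈ S.part a) (hy : y ∈ S.part b) (H : L →ₗ[ℂ] A) :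
    S.coadj ρ y H w = superSign a b • (ρ y * H w) + H (S.br w y) := by
  simp only [coadj, LinearMap.mk₂_apply, LinearMap.add_apply, LinearMap.sum_apply,
    LinearMap.smul_apply, LinearMap.comp_apply, LinearMap.mulLeft_apply, LinearMap.flip_apply,
    S.proj_of_mem hw, S.proj_of_mem hy]
  congr 1
  rw [Finset.sum_eq_single a, Finset.sum_eq_single b]
  · simp
  · intro d _ hd; simp [hd]
  · simp
  · intro c _ hc; simp [hc]
  · simp

theorem linearMap_ext_homogeneous (S : LieSuper L) {A : Type} [AddCommGroup A] [Module ℂ A]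
    {f g : L →ₗ[ℂ] A} (h : ∀ a, ∀ x ∈ S.part a, f x = g x) : f = g := by
  ext x
  refine S.homogeneous_induction (P := fun x => f x = g x) x h ?_
  intro x y hx hy
  rw [map_add, map_add, hx, hy]

/-- `br (br w y) z` in terms of `br w (br y z)`. -/
theorem br_br (S : LieSuper L) {a b c : ZMod 2} {w y z : L} (hw : w ∈ S.part a)
    (hy : y ∈ S.part b) (hz : z ∈ S.part c) :
    S.br (S.br w y) z = S.br w (S.br y z) + superSign b c • S.br (S.br w z) y := by
  rw [S.jacobi a b c w hw y hy z hz, S.skew _ _ y hy _ (S.br_mem a c w hw z hz),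
    superSign_add_right, superSign_comm b a, smul_neg, smul_smul, ← mul_assoc,
    superSign_mul_self, one_mul]
  abel

/-- The mixed terms, with one left factor and one bracket, cancel in pairs; the double brackets
combine by Jacobi in the form `br_br`. This is what lets `coadj` extend from a subalgebra on which
`ρ` respects brackets to its enveloping algebra. -/
theorem coadj_mul_coadj (S : LieSuper L) {A : Type} [Ring A] [Algebra ℂ A] (ρ : L →ₗ[ℂ] A)
    {b c : ZMod 2} {y z : L} (hy : y ∈ S.part b) (hz : z ∈ S.part c)
    (h : ρ y * ρ z = superSign b c • (ρ z * ρ y) + ρ (S.br y z)) :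
    S.coadj ρ y * S.coadj ρ z =
      superSign b c • (S.coadj ρ z * S.coadj ρ y) + S.coadj ρ (S.br y z) := by
  refine LinearMap.ext fun H => S.linearMap_ext_homogeneous fun a w hw => ?_
  simp only [Module.End.mul_apply, LinearMap.add_apply, LinearMap.smul_apply]
  have hwy := S.br_mem a b w hw y hy
  have hwz := S.br_mem a c w hw z hz
  rw [S.coadj_apply ρ hw hy, S.coadj_apply ρ hw hz, S.coadj_apply ρ hw hz,
    S.coadj_apply ρ hw hy, S.coadj_apply ρ hw (S.br_mem b c y hy z hz), S.coadj_apply ρ hwy hz,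
    S.coadj_apply ρ hwz hy, S.br_br hw hy hz]
  simp only [mul_add, mul_smul_comm, ← mul_assoc, h, superSign_add_left, superSign_add_right,
    superSign_comm c b, smul_add, smul_smul, map_add, map_smul, add_mul, smul_mul_assoc]
  match_scalars <;> first | ring1 | linear_combination -superSign a b * superSign_mul_self b c

end LieSuper

/-! ### The induced module of a split Lie superalgebra, realized on the enveloping algebra of the
complement. -/

namespace LieSuper

variable {L : Type} [AddCommGroup L] [Module ℂ L]

/-- A decomposition of a Lie superalgebra into two graded subalgebras, the range and the kernel of
a projection `p`, together with a character `lam` of the kernel. -/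
structure Splitting (S : LieSuper L) where
  p : L →ₗ[ℂ] L
  lam : L →ₗ[ℂ] ℂ
  p_mem : ∀ a : ZMod 2, ∀ x ∈ S.part a, p x ∈ S.part a
  p_p : ∀ x, p (p x) = p x
  p_br_range : ∀ x y, p (S.br (p x) (p y)) = S.br (p x) (p y)
  p_br_ker : ∀ x y, p x = 0 → p y = 0 → p (S.br x y) = 0
  lam_p : ∀ x, lam (p x) = 0
  lam_odd : ∀ x ∈ S.part 1, lam x = 0
  lam_br_ker : ∀ x y, p x = 0 → p y = 0 → lam (S.br x y) = 0

namespace Splitting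

variable {S : LieSuper L} (D : S.Splitting)

/-- The range of the projection as a Lie superalgebra. -/
noncomputable def neg : LieSuper (LinearMap.range D.p) :=
  S.sub (LinearMap.range D.p)
    (by
      rintro _ ⟨x, rfl⟩
      exact ⟨_, ⟨S.proj 0 x, rfl⟩, _, ⟨S.proj 1 x, rfl⟩, D.p_mem _ _ (S.proj_mem 0 x),
        D.p_mem _ _ (S.proj_mem 1 x), by rw [← map_add, S.proj_add_proj]⟩)
    (by
      rintro _ ⟨x, rfl⟩ _ ⟨y, rfl⟩
      exact ⟨_, D.p_br_range x y⟩)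

/-- The projection, as a map to the enveloping algebra of its range. -/
noncomputable def rho : L →ₗ[ℂ] D.neg.Env := D.neg.envι ∘ₗ D.p.rangeRestrict

theorem rho_p (x : L) : D.rho (D.p x) = D.rho x :=
  congrArg D.neg.envι (Subtype.ext (D.p_p x))

theorem p_coe (x : LinearMap.range D.p) : D.p x = x := by
  obtain ⟨_, x, rfl⟩ := x
  exact D.p_p x

theorem rho_of_ker {x : L} (h : D.p x = 0) : D.rho x = 0 := by
  rw [← rho_p, h, map_zero]

theorem envι_eq_rho (x : LinearMap.range D.p) : D.neg.envι x = D.rho x := by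
  obtain ⟨_, x, rfl⟩ := x
  rw [rho_p]
  rfl

theorem rho_mul_rho {a b : ZMod 2} {x y : L} (hx : x ∈ S.part a) (hy : y ∈ S.part b) :
    D.rho x * D.rho y =
      superSign a b • (D.rho y * D.rho x) + D.rho (S.br (D.p x) (D.p y)) := by
  have h := D.neg.envι_mul_envι (a := a) (b := b) (x := D.p.rangeRestrict x)
    (y := D.p.rangeRestrict y) (D.p_mem a x hx) (D.p_mem b y hy)
  rw [D.envι_eq_rho (D.neg.br _ _)] at h
  exact h

/-- The vector of `Hom(L, U)` attached to the character. -/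
noncomputable def seed : L →ₗ[ℂ] D.neg.Env :=
  D.rho + Algebra.linearMap ℂ D.neg.Env ∘ₗ D.lam

/-- The map `U → Hom(L, U)`, `u ↦ (w ↦ w • u)`, where `U` is the enveloping algebra of the range. -/
noncomputable def theta : D.neg.Env →ₐ[ℂ] Module.End ℂ (L →ₗ[ℂ] D.neg.Env) :=
  D.neg.envLift (A := Module.End ℂ (L →ₗ[ℂ] D.neg.Env))
    (S.coadj D.rho ∘ₗ (LinearMap.range D.p).subtype) fun a b x hx y hy => by
    refine S.coadj_mul_coadj D.rho (y := x.1) (z := y.1) hx hy ?_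
    have h := D.rho_mul_rho (a := a) (b := b) (x := x.1) (y := y.1) hx hy
    rwa [D.p_coe, D.p_coe] at h

theorem theta_envι (y : LinearMap.range D.p) : D.theta (D.neg.envι y) = S.coadj D.rho y :=
  D.neg.envLift_envι (A := Module.End ℂ (L →ₗ[ℂ] D.neg.Env)) _ _ y

/-- The action of `L` on the enveloping algebra of the range of the projection, which is thus
identified with the module induced from the character. -/
noncomputable def act : L →ₗ[ℂ] Module.End ℂ D.neg.Env :=
  LinearMap.mk₂ ℂ (fun w u => D.theta u D.seed w) (fun w w' u => map_add _ w w')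
    (fun c w u => map_smul _ c w) (fun w u v => by simp) (fun c w u => by simp)

theorem act_apply (w : L) (u : D.neg.Env) : D.act w u = D.theta u D.seed w := rfl

theorem act_one (w : L) : D.act w 1 = D.rho w + algebraMap ℂ _ (D.lam w) := by
  rw [act_apply, map_one]; rfl

theorem rho_eq_envι (y : L) : D.rho y = D.neg.envι (D.p.rangeRestrict y) := rfl

/-- This is the recursion w(yu) = ±y(wu) + [w,y]u that an induced module must satisfy. Defining w ↦
wu for all w at once, through `theta`, makes the recursion consistent without a PBW basis. -/
theorem act_rho_mul {a b : ZMod 2} {w y : L} (hw : w ∈ S.part a) (hy : y ∈ S.part b)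
    (u : D.neg.Env) :
    D.act w (D.rho y * u) =
      superSign a b • (D.rho y * D.act w u) + D.act (S.br w (D.p y)) u := by
  rw [act_apply, map_mul, rho_eq_envι, theta_envι, Module.End.mul_apply]
  refine (S.coadj_apply D.rho hw (D.p_mem b y hy) _).trans ?_
  rw [D.rho_p]
  rfl

theorem env_induction {P : D.neg.Env → Prop} (u : D.neg.Env) (one : P 1)
    (add : ∀ u v, P u → P v → P (u + v)) (smul : ∀ (c : ℂ) u, P u → P (c • u))
    (mul : ∀ b, ∀ y ∈ S.part b, ∀ u, P u → P (D.rho y * u)) : P u := by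
  refine D.neg.env_induction u one add smul fun x u hu => ?_
  rw [D.envι_eq_rho]
  refine S.homogeneous_induction (P := fun x => P (D.rho x * u)) x.1
    (fun a y hy => mul a y hy u hu) fun x y hx hy => ?_
  rw [map_add, add_mul]
  exact add _ _ hx hy

/-- The recursion only prescribes how to move past a factor, so that the range of `p` acts by left
multiplication has to be proved: the recursion and the relations of the enveloping algebra produce
the same commutator. -/
theorem act_p (y : L) (u : D.neg.Env) : D.act (D.p y) u = D.rho y * u := by
  induction u using D.env_induction generalizing y with
  | one => rw [act_one, rho_p, lam_p, map_zero, add_zero, mul_one]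
  | add u v hu hv => rw [map_add, hu, hv, mul_add]
  | smul c u hu => rw [map_smul, hu, mul_smul_comm]
  | mul b z hz u hu =>
    refine S.homogeneous_induction (P := fun y => D.act (D.p y) (D.rho z * u) =
      D.rho y * (D.rho z * u)) y (fun a y hy => ?_) fun x y hx hy => ?_
    -- The bracket of two elements of the range is again in the range, so the induction hypothesis
    -- applies to it as well.
    · rw [D.act_rho_mul (D.p_mem a y hy) hz, hu, ← D.p_br_range, hu, ← mul_assoc (D.rho y),
        D.rho_mul_rho hy hz, add_mul, smul_mul_assoc, mul_assoc]
    · rw [map_add, map_add, LinearMap.add_apply, hx, hy, map_add, add_mul]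

/-- The sign differs from 1 only for odd `x`, on which the character vanishes. -/
theorem lam_mul_lam {a : ZMod 2} (b : ZMod 2) {x : L} (hx : x ∈ S.part a) (y : L) :
    superSign a b * (D.lam x * D.lam y) = D.lam x * D.lam y := by
  rcases zmod2_cases a with rfl | rfl
  · simp [superSign]
  · simp [D.lam_odd x hx]

theorem act_act_one {a b : ZMod 2} {x y : L} (hx : x ∈ S.part a) (hy : y ∈ S.part b) :
    D.act x (D.act y 1) = superSign a b • D.act y (D.act x 1) + D.act (S.br x y) 1 := by
  have hxs : ∀ (x y : L) (a b : ZMod 2), x ∈ S.part a → y ∈ S.part b →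
      D.act x (D.act y 1) = superSign a b • (D.rho y * (D.rho x + algebraMap ℂ _ (D.lam x))) +
        (D.rho (S.br x (D.p y)) + algebraMap ℂ _ (D.lam (S.br x (D.p y)))) +
        D.lam y • (D.rho x + algebraMap ℂ _ (D.lam x)) := by
    intro x y a b hx hy
    have h := D.act_rho_mul hx hy 1
    rw [mul_one] at h
    rw [D.act_one y, map_add, h, D.act_one,
      Algebra.algebraMap_eq_smul_one (D.lam y), map_smul, D.act_one, D.act_one]
  -- Both arguments are split along `p`. The last bracket involves two elements of the kernel, so
  -- `p` and `lam` both annihilate it; this is where it matters that `lam` is a character of the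
  -- subalgebra `ker p`.
  have e : S.br x y + S.br (D.p x) (D.p y) = S.br x (D.p y) + S.br (D.p x) y +
      S.br (x - D.p x) (y - D.p y) := by
    simp only [map_sub, LinearMap.sub_apply]; abel
  have kx : D.p (x - D.p x) = 0 := by rw [map_sub, D.p_p, sub_self]
  have ky : D.p (y - D.p y) = 0 := by rw [map_sub, D.p_p, sub_self]
  have e1 := congrArg D.rho e
  have e2 := congrArg D.lam e
  have e3 := D.lam_p (S.br (D.p x) (D.p y))
  rw [D.p_br_range] at e3
  simp only [map_add] at e1 e2
  rw [D.rho_of_ker (D.p_br_ker _ _ kx ky), add_zero] at e1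
  rw [D.lam_br_ker _ _ kx ky, add_zero, e3, add_zero] at e2
  have e4 := S.skew b a y hy _ (D.p_mem a x hx)
  have e5 := D.rho_mul_rho hx hy
  have e6 := D.lam_mul_lam b hx y
  rw [hxs x y a b hx hy, hxs y x b a hy hx, D.act_one, e4, eq_sub_of_add_eq e1, e2]
  simp only [mul_add, e5, smul_add, map_neg, map_smul, smul_neg, smul_smul,
    superSign_comm b a, superSign_mul_self, one_smul, Algebra.algebraMap_eq_smul_one,
    mul_smul_comm, mul_one, smul_eq_mul, ← mul_assoc, map_add]
  match_scalars <;> first | ring1 | linear_combination e6 | linear_combination -e6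

/-- Induction on `u`: moving `x` and `y` past a factor z' reduces the relation to those for (x,y),
(x,[y,z']) and (y,[x,z']) on a shorter vector, which the Jacobi identity assembles. Hence the
generalization over `x` and `y`. -/
theorem act_act {a b : ZMod 2} {x y : L} (hx : x ∈ S.part a) (hy : y ∈ S.part b)
    (u : D.neg.Env) :
    D.act x (D.act y u) = superSign a b • D.act y (D.act x u) + D.act (S.br x y) u := by
  induction u using D.env_induction generalizing a b x y with
  | one => exact D.act_act_one hx hy
  | add u v hu hv => simp only [map_add, hu hx hy, hv hx hy, smul_add]; abel
  | smul c u hu =>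
    simp only [map_smul, hu hx hy, smul_add]
    rw [smul_comm]
  | mul c z hz u hu =>
    have hz' := D.p_mem c z hz
    have hxz := S.br_mem a c x hx _ hz'
    have hyz := S.br_mem b c y hy _ hz'
    have hxy := S.br_mem a b x hx y hy
    rw [D.act_rho_mul hy hz, D.act_rho_mul hx hz, D.act_rho_mul hxy hz]
    simp only [map_add, map_smul]
    rw [D.act_rho_mul hx hz, D.act_rho_mul hy hz, hu hx hyz, hu hy hxz, hu hx hy,
      S.jacobi a b c x hx y hy _ hz', S.skew _ _ y hy _ hxz]
    simp only [map_add, map_smul, map_neg, LinearMap.add_apply, LinearMap.smul_apply,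
      LinearMap.neg_apply, superSign_add_left, superSign_add_right, mul_add, mul_smul_comm,
      superSign_comm b a]
    match_scalars <;> first
      | ring1
      | linear_combination superSign a c * superSign_mul_self a b
      | linear_combination -superSign a c * superSign_mul_self a b
      | linear_combination superSign b c * superSign_mul_self a b
      | linear_combination -superSign b c * superSign_mul_self a b

/-- The action of the enveloping algebra of `L`. -/
noncomputable def rep : S.Env →ₐ[ℂ] Module.End ℂ D.neg.Env :=
  S.envLift (A := Module.End ℂ D.neg.Env) D.act fun _ _ _ hx _ hy => LinearMap.ext fun u => D.act_act hx hy u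

@[simp] theorem rep_envι (x : L) : D.rep (S.envι x) = D.act x :=
  S.envLift_envι (A := Module.End ℂ D.neg.Env) _ _ x

end Splitting

end LieSuper

/-! ### Polar parts of Laurent series. -/

namespace LaurC

theorem ext {f g : LaurC} (h : ∀ m, f.coeff m = g.coeff m) : f = g :=
  HahnSeries.ext (funext h)

@[simp] theorem coeff_zero (m : ℤ) : (0 : LaurC).coeff m = 0 := rfl

theorem coeff_sub (f g : LaurC) (m : ℤ) : (f - g).coeff m = f.coeff m - g.coeff m :=
  HahnSeries.coeff_sub ..

theorem coeff_tpow (k m : ℤ) : (tpow k).coeff m = if m = k then 1 else 0 := by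
  refine HahnSeries.coeff_single.trans ?_
  split_ifs <;> rfl

theorem coeff_mul_eq_zero {f g : LaurC} {m : ℤ}
    (h : ∀ i j, i + j = m → f.coeff i = 0 ∨ g.coeff j = 0) : (f * g).coeff m = 0 := by
  refine (HahnSeries.coeff_mul (x := (f : LaurentSeries ℂ)) (y := g)).trans ?_
  refine Finset.sum_eq_zero fun ij hij => ?_
  have := h ij.1 ij.2 (Finset.mem_antidiagonal.1 hij).2.2
  exact mul_eq_zero.2 this

theorem coeff_mul_tpow (f : LaurC) (k m : ℤ) : (f * tpow k).coeff m = f.coeff (m - k) := by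
  have h := HahnSeries.coeff_mul_single_add (r := (1 : ℂ)) (x := (f : LaurentSeries ℂ))
    (a := m - k) (b := k)
  rw [sub_add_cancel, mul_one] at h
  exact h

theorem one_eq_tpow : (1 : LaurC) = tpow 0 := rfl

/-- The polar part of a Laurent series. -/
def polar : LaurC →ₗ[ℂ] LaurC :=
  (HahnSeries.truncLTLinearMap ℂ (0 : ℤ) : LaurentSeries ℂ →ₗ[ℂ] LaurentSeries ℂ)

theorem coeff_polar (f : LaurC) (m : ℤ) :
    (polar f).coeff m = if m < 0 then f.coeff m else 0 := rfl

theorem polar_eq_self {f : LaurC} (h : ∀ m, 0 ≤ m → f.coeff m = 0) : polar f = f := by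
  refine ext fun m => ?_
  rw [coeff_polar]
  split_ifs with hm
  · rfl
  · exact (h m (not_lt.1 hm)).symm

theorem polar_eq_zero {f : LaurC} (h : ∀ m < 0, f.coeff m = 0) : polar f = 0 := by
  refine ext fun m => ?_
  rw [coeff_polar]
  split_ifs with hm
  · exact h m hm
  · rfl

theorem coeff_polar_of_nonneg (f : LaurC) {m : ℤ} (hm : 0 ≤ m) : (polar f).coeff m = 0 := by
  rw [coeff_polar, if_neg (not_lt.2 hm)]

theorem coeff_sub_polar (f : LaurC) {m : ℤ} (hm : m < 0) : (f - polar f).coeff m = 0 := by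
  rw [coeff_sub, coeff_polar, if_pos hm, sub_self]

theorem polar_mul_polar (f g : LaurC) : polar (polar f * polar g) = polar f * polar g := by
  refine polar_eq_self fun m hm => coeff_mul_eq_zero fun i j hij => ?_
  rcases lt_or_ge i 0 with hi | hi
  · exact Or.inr (coeff_polar_of_nonneg g (by omega))
  · exact Or.inl (coeff_polar_of_nonneg f hi)

theorem polar_mul_regular (f g : LaurC) : polar ((f - polar f) * (g - polar g)) = 0 := by
  refine polar_eq_zero fun m hm => coeff_mul_eq_zero fun i j hij => ?_
  rcases lt_or_ge i 0 with hi | hi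
  · exact Or.inl (coeff_sub_polar f hi)
  · exact Or.inr (coeff_sub_polar g (by omega))

theorem polar_D_regular (f : LaurC) : polar (laurentD (f - polar f)) = 0 := by
  refine polar_eq_zero fun m hm => ?_
  rw [laurentD_coeff]
  -- In degree -1 the constant term of the series need not vanish, but the factor m + 1 coming from
  -- differentiation does.
  rcases eq_or_ne m (-1) with rfl | h
  · simp
  · rw [coeff_sub_polar f (by omega), mul_zero]

theorem polar_D_polar (f : LaurC) : polar (laurentD (polar f)) = laurentD (polar f) := by
  refine polar_eq_self fun m hm => ?_
  rw [laurentD_coeff, coeff_polar_of_nonneg f (by omega), mul_zero]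

theorem res_D_mul_regular (f g : LaurC) :
    laurentRes (laurentD (f - polar f) * (g - polar g)) = 0 := by
  refine coeff_mul_eq_zero fun i j hij => ?_
  rcases lt_or_ge j 0 with hj | hj
  · exact Or.inr (coeff_sub_polar g hj)
  · left
    rw [laurentD_coeff]
    rcases eq_or_ne i (-1) with rfl | h
    · simp
    · rw [coeff_sub_polar f (by omega), mul_zero]

end LaurC

/-! ### The splitting of the affine algebra into t⁻¹g[t⁻¹] and g[[t]] ⊕ ℂK ⊕ ℂT. -/

section Loop

variable {L : Type} [AddCommGroup L] [Module ℂ L]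

/-- The polar part of an element of the loop algebra. -/
noncomputable def loopPolar (L : Type) [AddCommGroup L] [Module ℂ L] :
    (LaurC ⊗[ℂ] L) →ₗ[ℂ] (LaurC ⊗[ℂ] L) :=
  TensorProduct.map LaurC.polar LinearMap.id

@[simp] theorem loopPolar_tmul (f : LaurC) (x : L) :
    loopPolar L (f ⊗ₜ x) = LaurC.polar f ⊗ₜ x := rfl

theorem LaurC.polar_polar (f : LaurC) : LaurC.polar (LaurC.polar f) = LaurC.polar f :=
  LaurC.polar_eq_self fun _ hm => LaurC.coeff_polar_of_nonneg f hm

theorem loopPolar_loopPolar (z : LaurC ⊗[ℂ] L) : loopPolar L (loopPolar L z) = loopPolar L z := by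
  induction z with
  | zero => simp
  | add x y hx hy => simp only [map_add, hx, hy]
  | tmul f x => rw [loopPolar_tmul, loopPolar_tmul, LaurC.polar_polar]

theorem loopPolar_loopD (z : LaurC ⊗[ℂ] L) :
    loopPolar L (LieSuper.loopD L (loopPolar L z)) = LieSuper.loopD L (loopPolar L z) := by
  induction z with
  | zero => simp
  | add x y hx hy => simp only [map_add, hx, hy]
  | tmul f x => simp only [loopPolar_tmul, LieSuper.loopD_tmul, LaurC.polar_D_polar]

theorem loopPolar_loopD_regular (z : LaurC ⊗[ℂ] L) :
    loopPolar L (LieSuper.loopD L (z - loopPolar L z)) = 0 := by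
  induction z with
  | zero => simp
  | add x y hx hy => rw [map_add, add_sub_add_comm, map_add, map_add, hx, hy, add_zero]
  | tmul f x =>
    rw [loopPolar_tmul, ← TensorProduct.sub_tmul, LieSuper.loopD_tmul, loopPolar_tmul,
      LaurC.polar_D_regular, TensorProduct.zero_tmul]

theorem loopPolar_loopBr (S : LieSuper L) (z w : LaurC ⊗[ℂ] L) :
    loopPolar L (S.loopBr (loopPolar L z) (loopPolar L w)) =
      S.loopBr (loopPolar L z) (loopPolar L w) := by
  induction z with
  | zero => simp
  | add x y hx hy => simp only [map_add, LinearMap.add_apply, hx, hy]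
  | tmul f x =>
    induction w with
    | zero => simp
    | add x y hx hy => simp only [map_add, hx, hy]
    | tmul g y => simp only [loopPolar_tmul, LieSuper.loopBr_tmul, LaurC.polar_mul_polar]

theorem loopPolar_loopBr_regular (S : LieSuper L) (z w : LaurC ⊗[ℂ] L) :
    loopPolar L (S.loopBr (z - loopPolar L z) (w - loopPolar L w)) = 0 := by
  induction z with
  | zero => simp
  | add x y hx hy =>
    rw [map_add, add_sub_add_comm, map_add, LinearMap.add_apply, map_add, hx, hy, add_zero]
  | tmul f x =>
    induction w with
    | zero => simp
    | add x y hx hy =>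
      rw [map_add, add_sub_add_comm, map_add, map_add, hx, hy, add_zero]
    | tmul g y =>
      rw [loopPolar_tmul, loopPolar_tmul, ← TensorProduct.sub_tmul, ← TensorProduct.sub_tmul,
        LieSuper.loopBr_tmul, loopPolar_tmul, LaurC.polar_mul_regular, TensorProduct.zero_tmul]

theorem loopCocycle_regular {S : LieSuper L} (B : S.InvForm) (z w : LaurC ⊗[ℂ] L) :
    LieSuper.loopCocycle B (z - loopPolar L z) (w - loopPolar L w) = 0 := by
  induction z with
  | zero => simp
  | add x y hx hy =>
    rw [map_add, add_sub_add_comm, map_add, LinearMap.add_apply, hx, hy, add_zero]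
  | tmul f x =>
    induction w with
    | zero => simp
    | add x y hx hy => rw [map_add, add_sub_add_comm, map_add, hx, hy, add_zero]
    | tmul g y =>
      rw [loopPolar_tmul, loopPolar_tmul, ← TensorProduct.sub_tmul, ← TensorProduct.sub_tmul,
        LieSuper.loopCocycle_tmul, LaurC.res_D_mul_regular, zero_mul]

theorem loopPolar_mem (S : LieSuper L) (a : ZMod 2) {z : LaurC ⊗[ℂ] L} (hz : z ∈ S.loopPart a) :
    loopPolar L z ∈ S.loopPart a := by
  refine LieSuper.loop_ind (P := fun z => loopPolar L z ∈ S.loopPart a) ?_ ?_ ?_ hz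
  · exact fun f x hx => Submodule.subset_span ⟨_, x, hx, rfl⟩
  · intro x y hx hy; rw [map_add]; exact add_mem hx hy
  · intro c x hx; rw [map_smul]; exact Submodule.smul_mem _ _ hx

theorem loopPolar_of_mem_powerPart {z : LaurC ⊗[ℂ] L} (hz : z ∈ powerPart L 0) :
    loopPolar L z = 0 := by
  refine Submodule.span_induction (p := fun z _ => loopPolar L z = 0) ?_ (map_zero _)
    (fun x y _ _ hx hy => by rw [map_add, hx, hy, add_zero])
    (fun c x _ hx => by rw [map_smul, hx, smul_zero]) hz
  rintro _ ⟨f, x, hf, rfl⟩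
  rw [loopPolar_tmul, LaurC.polar_eq_zero hf, TensorProduct.zero_tmul]

theorem LieSuper.affine_br (S : LieSuper L) (B : S.InvForm) (p q : AffSpace L) :
    (S.affine B).br p q = (S.loopBr p.1 q.1 - p.2.2 • loopD L q.1 + q.2.2 • loopD L p.1,
      LieSuper.loopCocycle B p.1 q.1, 0) := rfl

theorem LieSuper.mem_affine_part (S : LieSuper L) (B : S.InvForm) {a : ZMod 2} {p : AffSpace L} :
    p ∈ (S.affine B).part a ↔ p.1 ∈ S.loopPart a ∧ (a = 0 ∨ p.2 = 0) := by
  change p.1 ∈ S.loopPart a ∧ p.2 ∈ (if a = 0 then (⊤ : Submodule ℂ (ℂ × ℂ)) else ⊥) ↔ _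
  by_cases h : a = 0 <;> simp [h]

/-- The splitting of the affine Lie superalgebra into `t⁻¹ g[t⁻¹]` and `g[[t]] ⊕ ℂ K ⊕ ℂ T`, with
the character of the latter that sends `K` to `k`. -/
noncomputable def affineSplitting (S : LieSuper L) (B : S.InvForm) (k : ℂ) :
    (S.affine B).Splitting where
  p := LinearMap.inl ℂ _ _ ∘ₗ loopPolar L ∘ₗ LinearMap.fst ℂ _ _
  lam := k • (LinearMap.fst ℂ ℂ ℂ ∘ₗ LinearMap.snd ℂ _ _)
  p_mem a x hx := by
    rw [LieSuper.mem_affine_part] at hx ⊢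
    exact ⟨loopPolar_mem S a hx.1, Or.inr rfl⟩
  p_p x := by simp [loopPolar_loopPolar]
  p_br_range x y := by
    -- For polar f and g, the product f'g involves only powers of t up to t⁻³, so it has no residue
    -- and t⁻¹g[t⁻¹] is closed under the centrally extended bracket.
    have h : LieSuper.loopCocycle B (loopPolar L x.1) (loopPolar L y.1) = 0 := by
      generalize x.1 = z
      generalize y.1 = w
      induction z with
      | zero => simp
      | add x y hx hy => simp only [map_add, LinearMap.add_apply, hx, hy, add_zero]
      | tmul f x =>
        induction w with
        | zero => simp
        | add x y hx hy => simp only [map_add, hx, hy, add_zero]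
        | tmul g y =>
          simp only [loopPolar_tmul, LieSuper.loopCocycle_tmul]
          refine mul_eq_zero_of_left (LaurC.coeff_mul_eq_zero fun i j hij => ?_) _
          rcases lt_or_ge j 0 with hj | hj
          · left
            rw [laurentD_coeff, LaurC.coeff_polar_of_nonneg f (by omega), mul_zero]
          · exact Or.inr (LaurC.coeff_polar_of_nonneg g hj)
    simp [LieSuper.affine_br, loopPolar_loopBr, h]; rfl
  p_br_ker x y hx hy := by
    have ex : loopPolar L x.1 = 0 := congrArg Prod.fst hx
    have ey : loopPolar L y.1 = 0 := congrArg Prod.fst hy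
    have h1 := loopPolar_loopBr_regular S x.1 y.1
    have h2 := loopPolar_loopD_regular x.1
    have h3 := loopPolar_loopD_regular y.1
    rw [ex, sub_zero] at h1 h2
    rw [ey, sub_zero] at h1 h3
    simp [LieSuper.affine_br, h1, h2, h3]
  lam_p x := by simp
  lam_odd x hx := by
    have h := ((LieSuper.mem_affine_part S B).1 hx).2.resolve_left (by decide)
    simp [h]
  lam_br_ker x y hx hy := by
    have ex : loopPolar L x.1 = 0 := congrArg Prod.fst hx
    have ey : loopPolar L y.1 = 0 := congrArg Prod.fst hy
    have h := loopCocycle_regular B x.1 y.1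
    rw [ex, ey, sub_zero, sub_zero] at h
    simp [LieSuper.affine_br, h]

theorem affineSplitting_p (S : LieSuper L) (B : S.InvForm) (k : ℂ) (x : AffSpace L) :
    (affineSplitting S B k).p x = (loopPolar L x.1, 0) := rfl

theorem affineSplitting_lam (S : LieSuper L) (B : S.InvForm) (k : ℂ) (x : AffSpace L) :
    (affineSplitting S B k).lam x = k * x.2.1 := rfl

/-- The map from `V^k(g)` to the enveloping algebra of `t⁻¹ g[t⁻¹]`. -/
noncomputable def univAffineToNeg (S : LieSuper L) (B : S.InvForm) (k : ℂ) :
    UnivAffine S B k →ₗ[ℂ] (affineSplitting S B k).neg.Env :=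
  ((vacuumIdeal S B k).restrictScalars ℂ).liftQ
    ((LinearMap.applyₗ (1 : (affineSplitting S B k).neg.Env)) ∘ₗ
      (affineSplitting S B k).rep.toLinearMap) (by
    intro u hu
    rw [Submodule.restrictScalars_mem] at hu
    rw [LinearMap.mem_ker]
    refine Submodule.span_induction (p := fun u _ => (affineSplitting S B k).rep u 1 = 0)
      ?_ (by simp) (fun x y _ _ hx hy => by rw [map_add, LinearMap.add_apply, hx, hy, add_zero])
      (fun c x _ hx => by
        rw [smul_eq_mul, map_mul, Module.End.mul_apply, hx, map_zero]) hu
    -- The ideal is a left ideal, so only its generators have to be checked: p lies in the kernel of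
    -- the projection, hence acts on 1 by its character alone.
    rintro _ ⟨p, hp, rfl⟩
    have h : (affineSplitting S B k).p p = 0 := by
      rw [affineSplitting_p, loopPolar_of_mem_powerPart hp]; rfl
    rw [map_sub, LinearMap.sub_apply, LieSuper.Splitting.rep_envι, LieSuper.Splitting.act_one,
      LieSuper.Splitting.rho_of_ker _ h, AlgHom.commutes, Module.algebraMap_end_apply,
      Algebra.algebraMap_eq_smul_one, zero_add, affineSplitting_lam, sub_self])

theorem univAffineToNeg_vacuum (S : LieSuper L) (B : S.InvForm) (k : ℂ) :
    univAffineToNeg S B k (vacuum S B k) = 1 := by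
  change (affineSplitting S B k).rep 1 1 = 1
  rw [map_one (affineSplitting S B k).rep]; rfl

theorem univAffineToNeg_smul (S : LieSuper L) (B : S.InvForm) (k : ℂ) (x : AffSpace L)
    (v : UnivAffine S B k) :
    univAffineToNeg S B k ((S.affine B).envι x • v) =
      (affineSplitting S B k).act x (univAffineToNeg S B k v) := by
  obtain ⟨u, rfl⟩ := (vacuumIdeal S B k).mkQ_surjective v
  change (affineSplitting S B k).rep ((S.affine B).envι x * u) 1 =
    (affineSplitting S B k).act x ((affineSplitting S B k).rep u 1)
  rw [map_mul, LieSuper.Splitting.rep_envι]; rfl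

end Loop

/-! ### Currents x f acting on y_(-1) z_(-1)|0⟩. -/

section Currents

variable {L : Type} [AddCommGroup L] [Module ℂ L]

theorem LaurC.coeff_one (m : ℤ) : (1 : LaurC).coeff m = if m = 0 then 1 else 0 := by
  rw [LaurC.one_eq_tpow, LaurC.coeff_tpow]

theorem laurentD_one : laurentD 1 = 0 := by
  refine LaurC.ext fun m => ?_
  rw [laurentD_coeff, LaurC.coeff_one, LaurC.coeff_zero]
  split_ifs with h
  · rw [mul_one]; exact_mod_cast h
  · exact mul_zero _

theorem laurentRes_D_mul_tpow (f : LaurC) :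
    laurentRes (laurentD f * LaurC.tpow (-1)) = f.coeff 1 := by
  refine (LaurC.coeff_mul_tpow _ _ _).trans ?_
  rw [laurentD_coeff]
  norm_num

/-- The element `f x` of the affine Lie superalgebra. -/
noncomputable def current (f : LaurC) : L →ₗ[ℂ] AffSpace L :=
  LinearMap.inl ℂ _ _ ∘ₗ TensorProduct.mk ℂ LaurC L f

theorem current_apply (f : LaurC) (x : L) : current f x = (f ⊗ₜ[ℂ] x, 0) := rfl

theorem mode_eq (S : LieSuper L) (B : S.InvForm) (x : L) (m : ℤ) :
    mode S B x m = (S.affine B).envι (current (LaurC.tpow m) x) := rfl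

theorem current_mem (S : LieSuper L) (B : S.InvForm) (f : LaurC) {a : ZMod 2} {x : L}
    (hx : x ∈ S.part a) : current f x ∈ (S.affine B).part a :=
  (S.mem_affine_part B).2 ⟨Submodule.subset_span ⟨f, x, hx, rfl⟩, Or.inr rfl⟩

theorem br_current (S : LieSuper L) (B : S.InvForm) (f g : LaurC) (x y : L) :
    (S.affine B).br (current f x) (current g y) =
      ((f * g) ⊗ₜ S.br x y, laurentRes (laurentD f * g) * B.form x y, 0) := by
  simp [LieSuper.affine_br, current_apply]

theorem tmul_mem_powerPart {N : ℤ} {f : LaurC} (hf : ∀ m < N, f.coeff m = 0) (x : L) :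
    f ⊗ₜ[ℂ] x ∈ powerPart L N := Submodule.subset_span ⟨f, x, hf, rfl⟩

theorem envι_smul_envι_smul (S : LieSuper L) {M : Type} [AddCommGroup M] [Module ℂ M]
    [Module S.Env M] [IsScalarTower ℂ S.Env M] {a b : ZMod 2} {x y : L} (hx : x ∈ S.part a)
    (hy : y ∈ S.part b) (v : M) :
    S.envι x • S.envι y • v =
      superSign a b • S.envι y • S.envι x • v + S.envι (S.br x y) • v := by
  rw [← mul_smul, S.envι_mul_envι hx hy, add_smul, smul_assoc, mul_smul]

theorem smul_smul_comm_env (S : LieSuper L) {M : Type} [AddCommGroup M] [Module ℂ M]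
    [Module S.Env M] [IsScalarTower ℂ S.Env M] (u : S.Env) (c : ℂ) (v : M) :
    u • c • v = c • u • v := by
  rw [← algebraMap_smul S.Env c v, ← algebraMap_smul S.Env c (u • v), ← mul_smul, ← mul_smul,
    Algebra.commutes]

/-- A vector annihilated by `g[[t]]` and `T`, on which `K` acts as `k`. -/
def IsVacuumVector (S : LieSuper L) (B : S.InvForm) (k : ℂ) {M : Type} [AddCommGroup M]
    [Module ℂ M] [Module (S.affine B).Env M] (v : M) : Prop :=
  ∀ p : AffSpace L, p.1 ∈ powerPart L 0 → (S.affine B).envι p • v = (k * p.2.1) • v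

theorem isVacuumVector_vacuum (S : LieSuper L) (B : S.InvForm) (k : ℂ) :
    IsVacuumVector S B k (vacuum S B k) := by
  intro p hp
  have h : (S.affine B).envι p - algebraMap ℂ (S.affine B).Env (k * p.2.1) ∈
      vacuumIdeal S B k := Submodule.subset_span ⟨p, hp, rfl⟩
  have h' := (Submodule.Quotient.eq (vacuumIdeal S B k)).2 h
  rw [Algebra.algebraMap_eq_smul_one] at h'
  refine Eq.trans ?_ h'
  exact congrArg (vacuumIdeal S B k).mkQ (mul_one _)

theorem current_smul_vacuum {S : LieSuper L} {B : S.InvForm} {k : ℂ} {M : Type} [AddCommGroup M]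
    [Module ℂ M] [Module (S.affine B).Env M] [IsScalarTower ℂ (S.affine B).Env M] {v : M}
    (hv : IsVacuumVector S B k v) {f : LaurC}
    (hf : ∀ m < 0, f.coeff m = 0) (x : L) : (S.affine B).envι (current f x) • v = 0 := by
  rw [hv _ (tmul_mem_powerPart hf x)]
  simp [current_apply]

/-- The action of `g[[t]]` with `f ∈ t ℂ[[t]]` on `y_(-1) z_(-1) |0⟩`. -/
theorem positive_current_smul {S : LieSuper L} {B : S.InvForm} {k : ℂ} {M : Type} [AddCommGroup M]
    [Module ℂ M] [Module (S.affine B).Env M] [IsScalarTower ℂ (S.affine B).Env M] {v : M}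
    (hv : IsVacuumVector S B k v) {f : LaurC}
    (hf : ∀ m < 1, f.coeff m = 0) {a : ZMod 2} {x y z : L} (hx : x ∈ S.part a)
    (hy : y ∈ S.part 1) (hz : z ∈ S.part 1) (hyz : S.br y z = 0)
    (h : (superSign a 1 * (k * B.form x z)) • y + (superSign (a + 1) 1 * (k * B.form x y)) • z +
      S.br (S.br x y) z = 0) :
    (S.affine B).envι (current f x) • mode S B y (-1) • mode S B z (-1) • v = 0 := by
  have hX := current_mem S B f hx
  have hY := current_mem S B (LaurC.tpow (-1)) hy
  have hZ := current_mem S B (LaurC.tpow (-1)) hz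
  have hXY := (S.affine B).br_mem _ _ _ hX _ hY
  have reg : ∀ m < 0, (f * LaurC.tpow (-1)).coeff m = 0 := fun m hm => by
    rw [LaurC.coeff_mul_tpow, hf _ (by omega)]
  have hxz : ∀ w : L, (S.affine B).envι ((S.affine B).br (current f x)
      (current (LaurC.tpow (-1)) w)) • v = (k * (f.coeff 1 * B.form x w)) •
        v := by
    intro w
    rw [br_current, hv _ (tmul_mem_powerPart reg _), laurentRes_D_mul_tpow]
  have hfx : (S.affine B).envι (current f x) • v = 0 :=
    current_smul_vacuum hv (fun m hm => hf m (by omega)) x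
  -- By invariance the double commutator has no central term.
  have h0 : B.form (S.br x y) z = 0 := by rw [B.inv, hyz, map_zero]
  have hlast : (S.affine B).envι ((S.affine B).br ((S.affine B).br (current f x)
      (current (LaurC.tpow (-1)) y)) (current (LaurC.tpow (-1)) z)) • v =
      f.coeff 1 • (S.affine B).envι (current (LaurC.tpow (-1)) (S.br (S.br x y) z)) •
        v := by
    -- Since f starts in degree 1, f t⁻² is its coefficient of t times t⁻¹ plus a regular series,
    -- and the regular part kills the vacuum vector.
    have e : (S.affine B).br ((S.affine B).br (current f x)
        (current (LaurC.tpow (-1)) y)) (current (LaurC.tpow (-1)) z) =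
        f.coeff 1 • current (LaurC.tpow (-1)) (S.br (S.br x y) z) +
        current (f * LaurC.tpow (-1) * LaurC.tpow (-1) - f.coeff 1 • LaurC.tpow (-1))
          (S.br (S.br x y) z) := by
      rw [br_current]
      simp only [LieSuper.affine_br, current_apply, LieSuper.loopBr_tmul,
        LieSuper.loopCocycle_tmul, h0, TensorProduct.sub_tmul]
      ext1 <;> simp [← TensorProduct.smul_tmul']
    rw [e, map_add, add_smul, map_smul, smul_assoc]
    refine add_eq_left.2 (current_smul_vacuum hv (fun m hm => ?_) _)
    rw [LaurC.coeff_sub, LaurC.coeff_smul, LaurC.coeff_mul_tpow, LaurC.coeff_mul_tpow,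
      LaurC.coeff_tpow]
    split_ifs with h
    · subst h; norm_num
    · rw [hf _ (by omega), mul_zero, sub_zero]
  rw [mode_eq, mode_eq, envι_smul_envι_smul _ hX hY, envι_smul_envι_smul _ hX hZ,
    envι_smul_envι_smul _ hXY hZ, hfx, smul_zero, smul_zero, zero_add, hxz, hxz, hlast,
    smul_smul_comm_env, smul_smul_comm_env, smul_smul, smul_smul]
  -- All remaining terms are (-1)-modes applied to the vacuum vector with the common factor `f.coeff
  -- 1`, so the assumed linear relation in g annihilates their sum.
  have h' := congrArg (fun w => f.coeff 1 • (S.affine B).envι (current (LaurC.tpow (-1)) w) •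
    v) h
  simp only [map_add, map_smul, add_smul, smul_add, map_zero, zero_smul, smul_zero, smul_assoc,
    smul_smul] at h'
  rw [← h', ← add_assoc]
  congr 3 <;> ring

/-- The action of `g` on `y_(-1) z_(-1) |0⟩`. -/
theorem constant_current_smul {S : LieSuper L} {B : S.InvForm} {k : ℂ} {M : Type} [AddCommGroup M]
    [Module ℂ M] [Module (S.affine B).Env M] [IsScalarTower ℂ (S.affine B).Env M] {v : M}
    (hv : IsVacuumVector S B k v) {a : ZMod 2}
    {x y z : L} (hx : x ∈ S.part a)
    (hy : y ∈ S.part 1) (hz : z ∈ S.part 1) (hzz : S.br z z = 0) (hxz : S.br x z = 0)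
    {c : ℂ} (hxy : S.br x y = c • z) :
    (S.affine B).envι (current 1 x) • mode S B y (-1) • mode S B z (-1) • v = 0 := by
  have hX := current_mem S B 1 hx
  have hY := current_mem S B (LaurC.tpow (-1)) hy
  have hZ := current_mem S B (LaurC.tpow (-1)) hz
  have hbr : ∀ w, (S.affine B).br (current 1 x) (current (LaurC.tpow (-1)) w) =
      current (LaurC.tpow (-1)) (S.br x w) := by
    intro w
    rw [br_current, laurentD_one, zero_mul, map_zero, zero_mul, one_mul]
    rfl
  have hX0 : (S.affine B).envι (current 1 x) • v = 0 :=
    current_smul_vacuum hv (fun m hm => by rw [LaurC.coeff_one, if_neg hm.ne]) x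
  -- The odd element z t⁻¹ has zero bracket with itself, so its square equals its own negative.
  have hZZ : mode S B z (-1) • mode S B z (-1) • v = 0 := by
    have h := envι_smul_envι_smul _ hZ hZ v
    have hres : laurentRes (laurentD (LaurC.tpow (-1)) * LaurC.tpow (-1)) = 0 := by
      rw [laurentRes_D_mul_tpow, LaurC.coeff_tpow, if_neg (by decide)]
    rw [br_current, hzz, TensorProduct.tmul_zero, hres, zero_mul,
      show ((0, 0, 0) : AffSpace L) = 0 from rfl, map_zero, zero_smul, add_zero] at h
    simp only [superSign, and_self, if_true, neg_smul, one_smul] at h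
    have h2 := add_eq_zero_iff_eq_neg.2 h
    rw [← two_smul ℂ, smul_eq_zero] at h2
    exact h2.resolve_left two_ne_zero
  rw [mode_eq] at hZZ
  rw [mode_eq, mode_eq, envι_smul_envι_smul _ hX hY, envι_smul_envι_smul _ hX hZ, hX0, hbr, hbr,
    hxz, hxy, map_zero, map_zero, zero_smul, map_smul, map_smul, smul_assoc, hZZ]
  simp

end Currents

/-! ### Elementary matrices in psl(n|n) and the identity special to level 1. -/

section PslMatrices

theorem single_mem_glPart {n : ℕ} (i j : Fin (2 * n)) (c : ℂ) :
    Matrix.single i j c ∈ glPart n (idxParity n i + idxParity n j) := by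
  refine ⟨Matrix.single i j c, ?_⟩
  ext k l
  simp only [blockProj, LinearMap.coe_mk, AddHom.coe_mk, Matrix.of_apply, Matrix.single_apply]
  split_ifs with h1 h2 h2
  · rfl
  · rfl
  · exact absurd (by rw [h2.1, h2.2]) h1
  · rfl

theorem pslE_mem {n : ℕ} {i j : Fin (2 * n)} (h : i ≠ j) :
    pslE i j h ∈ (psl n).part (idxParity n i + idxParity n j) :=
  ⟨⟨Matrix.single i j 1, single_mem_slSpace h⟩, single_mem_glPart i j 1, rfl⟩

theorem psl_br_mkQ {n : ℕ} (x y : slSpace n) :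
    (psl n).br ((scalarLine n).mkQ x) ((scalarLine n).mkQ y) =
      (scalarLine n).mkQ ((sl n).br x y) := rfl

theorem coe_sl_br {n : ℕ} (x y : slSpace n) : ((sl n).br x y : SuperMat n) = superComm n x y := rfl

theorem pslForm_mkQ {n : ℕ} (x y : slSpace n) :
    (pslForm n).form ((scalarLine n).mkQ x) ((scalarLine n).mkQ y) =
      superTrace n (x.1 * y.1) := rfl

theorem psl_br_pslE {n : ℕ} {i j k l : Fin (2 * n)} (h : i ≠ j) (h' : k ≠ l) :
    (psl n).br (pslE i j h) (pslE k l h') = (scalarLine n).mkQ ((sl n).br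
      ⟨Matrix.single i j 1, single_mem_slSpace h⟩ ⟨Matrix.single k l 1, single_mem_slSpace h'⟩) :=
  rfl

theorem psl_br_pslE_eq_zero {n : ℕ} {i j k l : Fin (2 * n)} (h : i ≠ j) (h' : k ≠ l)
    (hjk : j ≠ k) (hil : i ≠ l) : (psl n).br (pslE i j h) (pslE k l h') = 0 := by
  rw [psl_br_pslE]
  refine (congrArg _ (Subtype.ext ?_)).trans (map_zero (scalarLine n).mkQ)
  rw [coe_sl_br, superComm_apply (single_mem_glPart i j 1) (single_mem_glPart k l 1),
    Matrix.single_mul_single_of_ne (h := hjk), Matrix.single_mul_single_of_ne (h := hil.symm),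
    smul_zero, sub_zero]
  rfl

/-- Only proportionality is needed later, so the sign is left existential. -/
theorem psl_br_pslE_chain {n : ℕ} {i j k : Fin (2 * n)} (hij : i ≠ j) (hki : k ≠ i)
    (hkj : k ≠ j) : ∃ c : ℂ, (psl n).br (pslE i j hij) (pslE k i hki) = c • pslE k j hkj := by
  refine ⟨-superSign (idxParity n i + idxParity n j) (idxParity n k + idxParity n i), ?_⟩
  rw [psl_br_pslE, pslE, ← map_smul]
  refine congrArg _ (Subtype.ext ?_)
  rw [coe_sl_br, superComm_apply (single_mem_glPart i j 1) (single_mem_glPart k i 1),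
    Matrix.single_mul_single_of_ne (h := hkj.symm), Matrix.single_mul_single_same]
  simp

/-- The single diagonal entry sits in the odd block. The resulting minus sign makes the level +1
rather than -1 in `psl_contraction`. -/
theorem superTrace_mul_single {n : ℕ} (X : SuperMat n) {i q : Fin (2 * n)}
    (hq : idxParity n q = 1) : superTrace n (X * Matrix.single i q 1) = -X q i := by
  simp only [superTrace, LinearMap.coe_mk, AddHom.coe_mk]
  rw [Finset.sum_eq_single q]
  · simp [hq]
  · intro k _ hk
    simp [Matrix.mul_single_apply_of_ne _ _ _ _ _ hk]
  · simp

/-- With Y and Z the two elementary matrices, YZ = ZY = 0 leaves only YXZ = X_{pi}Z and ZXY =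
X_{qi}Y in the double supercommutator. The form values are -X_{pi} and -X_{qi}; for odd X the two
contributions cancel, and for even X these entries are zero. -/
theorem psl_contraction {n : ℕ} {a : ZMod 2} {x : PslSpace n} (hx : x ∈ (psl n).part a)
    {i p q : Fin (2 * n)} (hi : idxParity n i = 0) (hp : idxParity n p = 1)
    (hq : idxParity n q = 1) (hip : i ≠ p) (hiq : i ≠ q) :
    (superSign a 1 * (1 * (pslForm n).form x (pslE i q hiq))) • pslE i p hip +
      (superSign (a + 1) 1 * (1 * (pslForm n).form x (pslE i p hip))) • pslE i q hiq +
      (psl n).br ((psl n).br x (pslE i p hip)) (pslE i q hiq) = 0 := by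
  obtain ⟨⟨X, hX0⟩, hX, rfl⟩ := hx
  have hX : X ∈ glPart n a := hX
  rw [pslE, pslE, pslForm_mkQ, pslForm_mkQ, superTrace_mul_single X hq,
    superTrace_mul_single X hp, psl_br_mkQ, psl_br_mkQ, ← map_smul, ← map_smul, ← map_add,
    ← map_add]
  refine (congrArg _ (Subtype.ext ?_)).trans (map_zero (scalarLine n).mkQ)
  have hY := single_mem_glPart i p (1 : ℂ)
  have hZ := single_mem_glPart i q (1 : ℂ)
  rw [hi, hp, zero_add] at hY
  rw [hi, hq, zero_add] at hZ
  have hXY : X * Matrix.single i p 1 - superSign a 1 • (Matrix.single i p 1 * X) ∈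
      glPart n (a + 1) := by
    rw [← superComm_apply hX hY]
    exact (gl n).br_mem _ _ _ hX _ hY
  have e1 : Matrix.single i p (1 : ℂ) * X * Matrix.single i q 1 = X p i • Matrix.single i q 1 := by
    rw [Matrix.single_mul_mul_single]; simp
  have e2 : Matrix.single i q (1 : ℂ) * X * Matrix.single i p 1 = X q i • Matrix.single i p 1 := by
    rw [Matrix.single_mul_mul_single]; simp
  have e3 : Matrix.single i p (1 : ℂ) * Matrix.single i q 1 = 0 :=
    Matrix.single_mul_single_of_ne (h := hip.symm) ..
  have e4 : Matrix.single i q (1 : ℂ) * Matrix.single i p 1 = 0 :=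
    Matrix.single_mul_single_of_ne (h := hiq.symm) ..
  have hX' := blockProj_of_mem hX a
  rw [if_pos rfl] at hX'
  -- An entry with an odd row and the even column i lies in an off-diagonal block.
  have odd : ∀ r, idxParity n r = 1 → a = 0 → X r i = 0 := by
    rintro r hr rfl
    rw [← hX']
    simp [blockProj, hr, hi]
  change (superSign a 1 * (1 * -X q i)) • Matrix.single i p (1 : ℂ) +
    (superSign (a + 1) 1 * (1 * -X p i)) • Matrix.single i q (1 : ℂ) +
    superComm n (superComm n X (Matrix.single i p 1)) (Matrix.single i q 1) = 0
  rw [superComm_apply hX hY, superComm_apply hXY hZ, sub_mul, mul_sub,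
    mul_assoc X, e3, mul_zero,
    smul_mul_assoc, e1, ← mul_assoc (Matrix.single i q (1 : ℂ)), e2, mul_smul_comm, ← mul_assoc (Matrix.single i q (1 : ℂ)), e4, zero_mul, smul_zero, sub_zero]
  rcases zmod2_cases a with rfl | rfl
  · simp [odd p hp rfl, odd q hq rfl]
  · simp [superSign, show (1 : ZMod 2) + 1 = 0 by decide]
    abel

end PslMatrices

/-- Constant currents reduce to elementary matrices and currents in t g[[t]] to homogeneous
elements. Only the relations satisfied by a vacuum vector enter, so the module is arbitrary. -/
theorem affNPlus_smul_eq_zero (n : ℕ) (hn : 2 ≤ n) {M : Type} [AddCommGroup M] [Module ℂ M]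
    [Module ((psl n).affine (pslForm n)).Env M] [IsScalarTower ℂ ((psl n).affine (pslForm n)).Env M]
    {v : M} (hv : IsVacuumVector (psl n) (pslForm n) 1 v) : ∀ w ∈ affNPlus (pslNPlus n),
    ((psl n).affine (pslForm n)).envι w •
      modeE (⟨0, by omega⟩ : Fin (2 * n)) ⟨2 * n - 2, by omega⟩
        (by rw [Ne, Fin.mk.injEq]; omega) (-1) •
      modeE (⟨0, by omega⟩ : Fin (2 * n)) ⟨2 * n - 1, by omega⟩
        (by rw [Ne, Fin.mk.injEq]; omega) (-1) • v = 0 := by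
  set i : Fin (2 * n) := ⟨0, by omega⟩ with hi'
  set p : Fin (2 * n) := ⟨2 * n - 2, by omega⟩ with hp'
  set q : Fin (2 * n) := ⟨2 * n - 1, by omega⟩ with hq'
  have hip : i ≠ p := by rw [Ne, Fin.mk.injEq]; omega
  have hiq : i ≠ q := by rw [Ne, Fin.mk.injEq]; omega
  have hi : idxParity n i = 0 := if_pos (by simp only [hi']; omega)
  have hp : idxParity n p = 1 := if_neg (by simp only [hp']; omega)
  have hq : idxParity n q = 1 := if_neg (by simp only [hq']; omega)
  have hy := pslE_mem hip
  have hz := pslE_mem hiq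
  rw [hi, hp, zero_add] at hy
  rw [hi, hq, zero_add] at hz
  rintro _ ⟨w, hw, rfl⟩
  change ((psl n).affine (pslForm n)).envι (w, 0) • mode (psl n) (pslForm n) (pslE i p hip) (-1) •
    mode (psl n) (pslForm n) (pslE i q hiq) (-1) • v = 0
  obtain ⟨_, ⟨x, hx, rfl⟩, z, hz', rfl⟩ := Submodule.mem_sup.1 hw
  rw [show (((TensorProduct.mk ℂ LaurC (PslSpace n)) 1 x + z, 0) : AffSpace (PslSpace n)) =
    current 1 x + (z, 0) by simp [current_apply], map_add, add_smul]
  refine (congrArg₂ (· + ·) ?_ ?_).trans (add_zero 0)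
  · refine Submodule.span_induction (p := fun x _ => ((psl n).affine (pslForm n)).envι
      (current 1 x) • mode (psl n) (pslForm n) (pslE i p hip) (-1) •
      mode (psl n) (pslForm n) (pslE i q hiq) (-1) • v = 0)
      ?_ (by simp) (fun x y _ _ hx hy => by rw [map_add, map_add, add_smul, hx, hy, add_zero])
      (fun c x _ hx => by rw [map_smul, map_smul, smul_assoc, hx, smul_zero]) hx
    rintro _ ⟨k, l, hkl, rfl⟩
    have hkl' : k.1 < l.1 := hkl
    have hl := l.2
    -- Since k < l, the column l is not the first index and the row k is not the last one; hence the
    -- bracket with z vanishes.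
    have hli : l ≠ i := by rw [Ne, Fin.ext_iff]; simp only [hi']; omega
    have hkq : k ≠ q := by rw [Ne, Fin.ext_iff]; simp only [hq']; omega
    have hqi : (psl n).br (pslE i q hiq) (pslE i q hiq) = 0 :=
      psl_br_pslE_eq_zero _ _ hiq.symm hiq
    have hxz := psl_br_pslE_eq_zero hkl.ne hiq hli hkq
    -- The bracket with y is non-zero only if k is the penultimate index, which forces l to be the
    -- last one; the result is then a multiple of z.
    by_cases hkp : k = p
    · have hlq : l = q := by
        rw [Fin.ext_iff]
        have := congrArg Fin.val hkp
        simp only [hp', hq'] at this ⊢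
        omega
      subst hkp hlq
      obtain ⟨c, hc⟩ := psl_br_pslE_chain hkl.ne hip hiq
      exact constant_current_smul hv (pslE_mem hkl.ne) hy hz hqi hxz hc
    · exact constant_current_smul hv (pslE_mem hkl.ne) hy hz hqi hxz (c := 0)
        (by rw [psl_br_pslE_eq_zero hkl.ne hip hli hkp, zero_smul])
  · refine Submodule.span_induction (p := fun z _ => ((psl n).affine (pslForm n)).envι
      (z, 0) • mode (psl n) (pslForm n) (pslE i p hip) (-1) •
      mode (psl n) (pslForm n) (pslE i q hiq) (-1) • v = 0)
      ?_ (by rw [show ((0, 0) : AffSpace (PslSpace n)) = 0 from rfl, map_zero, zero_smul])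
      (fun x y _ _ hx hy => by
        rw [show ((x + y, 0) : AffSpace (PslSpace n)) = (x, 0) + (y, 0) by simp, map_add,
          add_smul, hx, hy, add_zero])
      (fun c x _ hx => by
        rw [show ((c • x, 0) : AffSpace (PslSpace n)) = c • (x, 0) by simp, map_smul,
          smul_assoc, hx, smul_zero]) hz'
    rintro _ ⟨f, x, hf, rfl⟩
    refine (psl n).homogeneous_induction (P := fun x => ((psl n).affine (pslForm n)).envι
      (current f x) • mode (psl n) (pslForm n) (pslE i p hip) (-1) •
      mode (psl n) (pslForm n) (pslE i q hiq) (-1) • v = 0) x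
      (fun a x hx => ?_) (fun x y hx hy => by rw [map_add, map_add, add_smul, hx, hy, add_zero])
    exact positive_current_smul hv hf hx hy hz (psl_br_pslE_eq_zero _ _ hip.symm hiq)
      (psl_contraction hx hi hp hq hip hiq)

theorem isSingularVector_chi (n : ℕ) (hn : 2 ≤ n) :
    IsSingularVector (psl n) (pslForm n) 1 (pslNPlus n) (chi n hn) :=
  affNPlus_smul_eq_zero n hn (isVacuumVector_vacuum (psl n) (pslForm n) 1)

/-! ### Detecting χ in the exterior algebra of a plane. -/

section NonVanishing

variable {L : Type} [AddCommGroup L] [Module ℂ L]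

/-- Left multiplication by the first generator of the exterior algebra of a plane. -/
noncomputable def exteriorLeft : Matrix (Fin 4) (Fin 4) ℂ :=
  !![0, 0, 0, 0; 1, 0, 0, 0; 0, 0, 0, 0; 0, 0, 1, 0]

/-- Left multiplication by the second generator of the exterior algebra of a plane. -/
noncomputable def exteriorRight : Matrix (Fin 4) (Fin 4) ℂ :=
  !![0, 0, 0, 0; 0, 0, 0, 0; 1, 0, 0, 0; 0, -1, 0, 0]

/-- In the basis 1, e₁, e₂, e₁∧e₂, left multiplication by a product of two vectors sends 1 to their
determinant times the top form and kills the rest. -/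
theorem exterior_mul (a b c d : ℂ) :
    (a • exteriorLeft + b • exteriorRight) * (c • exteriorLeft + d • exteriorRight) =
      Matrix.single 3 0 (a * d - b * c) := by
  ext i j
  fin_cases i <;> fin_cases j <;>
    simp [exteriorLeft, exteriorRight, Matrix.mul_apply, Fin.sum_univ_four]
  ring

/-- The functional `f x ↦ Res(f) E(x)` on the affine Lie superalgebra. -/
noncomputable def affineRes (E : L →ₗ[ℂ] ℂ) : AffSpace L →ₗ[ℂ] ℂ :=
  (TensorProduct.lid ℂ ℂ).toLinearMap ∘ₗ TensorProduct.map laurentRes E ∘ₗ LinearMap.fst ℂ _ _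

theorem affineRes_current (E : L →ₗ[ℂ] ℂ) (x : L) :
    affineRes E (current (LaurC.tpow (-1)) x) = E x := by
  have h : laurentRes (LaurC.tpow (-1)) = 1 := (LaurC.coeff_tpow _ _).trans (if_pos rfl)
  simp [affineRes, current_apply, h]

/-- A product of two polar series has no term above t⁻², hence no residue. Thus t⁻¹g[t⁻¹] may act
through its residues as if it were abelian. -/
theorem affineRes_br (S : LieSuper L) (B : S.InvForm) (E : L →ₗ[ℂ] ℂ) (x y : AffSpace L) :
    affineRes E ((S.affine B).br (loopPolar L x.1, 0) (loopPolar L y.1, 0)) = 0 := by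
  simp only [LieSuper.affine_br, affineRes, LinearMap.comp_apply, LinearMap.fst_apply,
    Prod.snd_zero, zero_smul, sub_zero, add_zero]
  generalize x.1 = z
  generalize y.1 = w
  induction z with
  | zero => simp
  | add x y hx hy => simp only [map_add, LinearMap.add_apply, hx, hy, add_zero]
  | tmul f x =>
    induction w with
    | zero => simp
    | add x y hx hy => simp only [map_add, hx, hy, add_zero]
    | tmul g y =>
      have h : laurentRes (LaurC.polar f * LaurC.polar g) = 0 := by
        refine LaurC.coeff_mul_eq_zero fun i j hij => ?_
        rcases lt_or_ge i 0 with hi | hi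
        · exact Or.inr (LaurC.coeff_polar_of_nonneg g (by omega))
        · exact Or.inl (LaurC.coeff_polar_of_nonneg f hi)
      simp [h]

theorem affineRes_even (S : LieSuper L) (B : S.InvForm) {E : L →ₗ[ℂ] ℂ}
    (hE : ∀ x ∈ S.part 0, E x = 0) : ∀ x ∈ (S.affine B).part 0, affineRes E x = 0 := by
  intro x hx
  have h := ((S.mem_affine_part B).1 hx).1
  simp only [affineRes, LinearMap.comp_apply, LinearMap.fst_apply]
  refine LieSuper.loop_ind (P := fun z => (TensorProduct.lid ℂ ℂ).toLinearMap
    (TensorProduct.map laurentRes E z) = 0) ?_ ?_ ?_ h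
  · intro f x hx; simp [hE x hx]
  · intro x y hx hy; rw [map_add, map_add, hx, hy, add_zero]
  · intro c x hx; rw [map_smul, map_smul, hx, smul_zero]

/-- The representation of `t⁻¹ g[t⁻¹]` on the exterior algebra of a plane given by two functionals
on the odd part of `g`. -/
noncomputable def exteriorRep (S : LieSuper L) (B : S.InvForm) (k : ℂ) {E F : L →ₗ[ℂ] ℂ}
    (hE : ∀ x ∈ S.part 0, E x = 0) (hF : ∀ x ∈ S.part 0, F x = 0) :
    (affineSplitting S B k).neg.Env →ₐ[ℂ] Matrix (Fin 4) (Fin 4) ℂ :=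
  (affineSplitting S B k).neg.envLift
    (((affineRes E).smulRight exteriorLeft + (affineRes F).smulRight exteriorRight) ∘ₗ
      (LinearMap.range (affineSplitting S B k).p).subtype) (by
    rintro a b ⟨_, x, rfl⟩ hx ⟨_, y, rfl⟩ hy
    have hx' : (affineSplitting S B k).p x ∈ (S.affine B).part a := hx
    have hy' : (affineSplitting S B k).p y ∈ (S.affine B).part b := hy
    have hb : ∀ G : L →ₗ[ℂ] ℂ, affineRes G ((S.affine B).br ((affineSplitting S B k).p x)
      ((affineSplitting S B k).p y)) = 0 := fun G => affineRes_br S B G x y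
    change (affineRes E ((affineSplitting S B k).p x) • exteriorLeft +
        affineRes F ((affineSplitting S B k).p x) • exteriorRight) *
      (affineRes E ((affineSplitting S B k).p y) • exteriorLeft +
        affineRes F ((affineSplitting S B k).p y) • exteriorRight) =
      superSign a b • ((affineRes E ((affineSplitting S B k).p y) • exteriorLeft +
        affineRes F ((affineSplitting S B k).p y) • exteriorRight) *
        (affineRes E ((affineSplitting S B k).p x) • exteriorLeft +
        affineRes F ((affineSplitting S B k).p x) • exteriorRight)) +
      (affineRes E ((S.affine B).br ((affineSplitting S B k).p x)
        ((affineSplitting S B k).p y)) • exteriorLeft +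
       affineRes F ((S.affine B).br ((affineSplitting S B k).p x)
        ((affineSplitting S B k).p y)) • exteriorRight)
    rw [hb, hb, exterior_mul, exterior_mul, zero_smul, zero_smul, add_zero, add_zero,
      Matrix.smul_single]
    congr 1
    -- If either element is even, both functionals vanish on it. If both are odd, the sign -1
    -- matches the antisymmetry of the determinant.
    rcases zmod2_cases a with rfl | rfl
    · rw [affineRes_even S B hE _ hx', affineRes_even S B hF _ hx']; simp
    rcases zmod2_cases b with rfl | rfl
    · rw [affineRes_even S B hE _ hy', affineRes_even S B hF _ hy']; simp
    simp [superSign]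
    ring)

theorem exteriorRep_rho (S : LieSuper L) (B : S.InvForm) (k : ℂ) {E F : L →ₗ[ℂ] ℂ}
    (hE : ∀ x ∈ S.part 0, E x = 0) (hF : ∀ x ∈ S.part 0, F x = 0) (x : AffSpace L) :
    exteriorRep S B k hE hF ((affineSplitting S B k).rho x) =
      affineRes E ((affineSplitting S B k).p x) • exteriorLeft +
        affineRes F ((affineSplitting S B k).p x) • exteriorRight := by
  rw [LieSuper.Splitting.rho_eq_envι, exteriorRep, LieSuper.envLift_envι]
  rfl

theorem affineSplitting_p_mode (S : LieSuper L) (B : S.InvForm) (k : ℂ) (x : L) :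
    (affineSplitting S B k).p (current (LaurC.tpow (-1)) x) = current (LaurC.tpow (-1)) x := by
  rw [affineSplitting_p, current_apply, loopPolar_tmul, LaurC.polar_eq_self]
  intro m hm
  rw [LaurC.coeff_tpow, if_neg (by omega)]

theorem mode_mode_vacuum_ne_zero (S : LieSuper L) (B : S.InvForm) (k : ℂ) {E F : L →ₗ[ℂ] ℂ}
    (hE : ∀ x ∈ S.part 0, E x = 0) (hF : ∀ x ∈ S.part 0, F x = 0) {y z : L}
    (h : E y * F z - F y * E z ≠ 0) :
    mode S B y (-1) • mode S B z (-1) • vacuum S B k ≠ 0 := by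
  intro h0
  have h1 := congrArg (exteriorRep S B k hE hF) (congrArg (univAffineToNeg S B k) h0)
  rw [mode_eq, mode_eq, univAffineToNeg_smul, univAffineToNeg_smul, univAffineToNeg_vacuum,
    ← affineSplitting_p_mode S B k y, ← affineSplitting_p_mode S B k z,
    LieSuper.Splitting.act_p, LieSuper.Splitting.act_p, mul_one, map_mul, exteriorRep_rho,
    exteriorRep_rho, exterior_mul, affineSplitting_p_mode, affineSplitting_p_mode,
    affineRes_current, affineRes_current, affineRes_current, affineRes_current,
    map_zero (univAffineToNeg S B k), map_zero (exteriorRep S B k hE hF)] at h1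
  -- Row 3, column 0 is the coefficient of the top form in the image of 1.
  have h2 := congrFun (congrFun h1 3) 0
  rw [Matrix.single_apply_same] at h2
  exact h h2

/-- The matrix entry at an off-diagonal position, as a functional on `psl(n|n)`. -/
noncomputable def pslEntry {n : ℕ} (i j : Fin (2 * n)) (h : i ≠ j) : PslSpace n →ₗ[ℂ] ℂ :=
  (scalarLine n).liftQ (Matrix.entryLinearMap ℂ ℂ i j ∘ₗ (slSpace n).subtype) (by
    rw [scalarLine, Submodule.span_singleton_le_iff_mem]
    exact Matrix.one_apply_ne h)

theorem pslEntry_even {n : ℕ} {i j : Fin (2 * n)} (h : i ≠ j)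
    (hij : idxParity n i + idxParity n j = 1) : ∀ x ∈ (psl n).part 0, pslEntry i j h x = 0 := by
  rintro _ ⟨x, hx, rfl⟩
  have hx : x.1 ∈ glPart n 0 := hx
  have h0 := blockProj_of_mem hx 0
  rw [if_pos rfl] at h0
  change x.1 i j = 0
  rw [← h0]
  simp [blockProj, hij]

theorem pslEntry_pslE {n : ℕ} {i j k l : Fin (2 * n)} (h : i ≠ j) (h' : k ≠ l) :
    pslEntry i j h (pslE k l h') = if k = i ∧ l = j then 1 else 0 := by
  change Matrix.single k l (1 : ℂ) i j = _
  rw [Matrix.single_apply]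

end NonVanishing

theorem chi_ne_zero (n : ℕ) (hn : 2 ≤ n) : chi n hn ≠ 0 := by
  have hi : idxParity n (⟨0, by omega⟩ : Fin (2 * n)) = 0 := if_pos (by simp only; omega)
  have hp : idxParity n (⟨2 * n - 2, by omega⟩ : Fin (2 * n)) = 1 :=
    if_neg (by simp only; omega)
  have hq : idxParity n (⟨2 * n - 1, by omega⟩ : Fin (2 * n)) = 1 :=
    if_neg (by simp only; omega)
  have hip : (⟨0, by omega⟩ : Fin (2 * n)) ≠ ⟨2 * n - 2, by omega⟩ := by
    rw [Ne, Fin.mk.injEq]; omega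
  have hiq : (⟨0, by omega⟩ : Fin (2 * n)) ≠ ⟨2 * n - 1, by omega⟩ := by
    rw [Ne, Fin.mk.injEq]; omega
  refine mode_mode_vacuum_ne_zero _ _ _ (pslEntry_even hip (by rw [hi, hp, zero_add]))
    (pslEntry_even hiq (by rw [hi, hq, zero_add])) ?_
  rw [pslEntry_pslE, pslEntry_pslE, pslEntry_pslE, pslEntry_pslE]
  have h : 2 * n - 2 ≠ 2 * n - 1 := by omega
  simp [h]

/-! ### Keeping the submodule generated by χ inside n_-V. -/

section Proper

variable {L : Type} [AddCommGroup L] [Module ℂ L]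

theorem LaurC.eq_regular_decomposition {f : LaurC} (hf : ∀ m < 0, f.coeff m = 0) :
    ∃ g : LaurC, (∀ m < 1, g.coeff m = 0) ∧ f = f.coeff 0 • 1 + g := by
  refine ⟨f - f.coeff 0 • 1, fun m hm => ?_, by abel⟩
  rw [LaurC.coeff_sub, LaurC.coeff_smul, LaurC.coeff_one]
  split_ifs with h
  · rw [h, mul_one, sub_self]
  · rw [hf m (by omega), mul_zero, sub_zero]

variable {M : Type} [AddCommGroup M] [Module ℂ M]

/-- The span of the vectors `y m`, with `y` a homogeneous element of `t⁻¹ g[t⁻¹]`. -/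
def negImage (S : LieSuper L) (B : S.InvForm) (M : Type) [AddCommGroup M] [Module ℂ M]
    [Module (S.affine B).Env M] : Submodule ℂ M :=
  Submodule.span ℂ {m | ∃ (b : ZMod 2) (p : AffSpace L) (m' : M), p ∈ (S.affine B).part b ∧
    loopPolar L p.1 = p.1 ∧ p.2 = 0 ∧ m = (S.affine B).envι p • m'}

variable {S : LieSuper L} {B : S.InvForm} [Module (S.affine B).Env M]
  [IsScalarTower ℂ (S.affine B).Env M]

/-- Since x p m' = ±p x m' + [x,p] m', it suffices that x normalizes t⁻¹g[t⁻¹]. -/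
theorem negImage_stable {a : ZMod 2} {x : AffSpace L} (hx : x ∈ (S.affine B).part a)
    (h : ∀ p : AffSpace L, loopPolar L p.1 = p.1 → p.2 = 0 →
      loopPolar L ((S.affine B).br x p).1 = ((S.affine B).br x p).1 ∧
      ((S.affine B).br x p).2 = 0) {m : M} (hm : m ∈ negImage S B M) :
    (S.affine B).envι x • m ∈ negImage S B M := by
  refine Submodule.span_induction (p := fun m _ => (S.affine B).envι x • m ∈ negImage S B M)
    ?_ (by rw [smul_zero]; exact zero_mem _)
    (fun u v _ _ hu hv => by rw [smul_add]; exact add_mem hu hv)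
    (fun c u _ hu => by
      rw [smul_smul_comm_env]; exact Submodule.smul_mem _ _ hu) hm
  rintro _ ⟨b, p, m', hp, hp1, hp2, rfl⟩
  rw [envι_smul_envι_smul _ hx hp]
  obtain ⟨h1, h2⟩ := h p hp1 hp2
  exact add_mem (Submodule.smul_mem _ _ (Submodule.subset_span ⟨b, p, _, hp, hp1, hp2, rfl⟩))
    (Submodule.subset_span ⟨a + b, _, m', (S.affine B).br_mem a b x hx p hp, h1, h2, rfl⟩)

/-- Constants have zero derivative, so no central term appears, and multiplying by 1 keeps polar
series polar. -/
theorem constant_smul_mem_negImage {a : ZMod 2} {w : L} (hw : w ∈ S.part a) {m : M}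
    (hm : m ∈ negImage S B M) : (S.affine B).envι (current 1 w) • m ∈ negImage S B M := by
  refine negImage_stable (current_mem S B 1 hw) (fun p hp1 hp2 => ?_) hm
  have key : ∀ z : LaurC ⊗[ℂ] L, loopPolar L (S.loopBr (1 ⊗ₜ w) (loopPolar L z)) =
      S.loopBr (1 ⊗ₜ w) (loopPolar L z) ∧ LieSuper.loopCocycle B (1 ⊗ₜ w) z = 0 := by
    intro z
    induction z with
    | zero => simp
    | add x y hx hy => simp only [map_add, hx.1, hx.2, hy.1, hy.2, add_zero, and_self]
    | tmul f x => simp [laurentD_one, LaurC.polar_polar]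
  obtain ⟨h1, h2⟩ := key p.1
  rw [hp1] at h1
  simp [LieSuper.affine_br, current_apply, hp2, h1, h2]

/-- K is central, and T differentiates, which preserves polar series. -/
theorem central_smul_mem_negImage (c : ℂ × ℂ) {m : M} (hm : m ∈ negImage S B M) :
    (S.affine B).envι (0, c) • m ∈ negImage S B M := by
  refine negImage_stable (a := 0)
    ((S.mem_affine_part B).2 ⟨zero_mem _, Or.inl rfl⟩) (fun p hp1 hp2 => ?_) hm
  have h := loopPolar_loopD p.1
  rw [hp1] at h
  simp [LieSuper.affine_br, hp2, h]

/-- The vectors of `negImage` annihilated by `t g[[t]]`. -/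
def negSingular (S : LieSuper L) (B : S.InvForm) (M : Type) [AddCommGroup M] [Module ℂ M]
    [Module (S.affine B).Env M] [IsScalarTower ℂ (S.affine B).Env M] : Submodule ℂ M where
  carrier := {m | m ∈ negImage S B M ∧ ∀ g : LaurC, (∀ i < 1, g.coeff i = 0) → ∀ x : L,
    (S.affine B).envι (current g x) • m = 0}
  zero_mem' := ⟨zero_mem _, fun g _ x => smul_zero _⟩
  add_mem' := fun hu hv => ⟨add_mem hu.1 hv.1, fun g hg x => by
    rw [smul_add, hu.2 g hg x, hv.2 g hg x, add_zero]⟩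
  smul_mem' := fun c u hu => ⟨Submodule.smul_mem _ c hu.1, fun g hg x => by
    rw [smul_smul_comm_env, hu.2 g hg x, smul_zero]⟩

/-- Bracketing with a constant keeps t g[[t]] inside itself, without a central term because Res(g')
= 0. -/
theorem constant_smul_mem_negSingular (w : L) {m : M} (hm : m ∈ negSingular S B M) :
    (S.affine B).envι (current 1 w) • m ∈ negSingular S B M := by
  refine S.homogeneous_induction
    (P := fun w => (S.affine B).envι (current 1 w) • m ∈ negSingular S B M) w
    (fun a w hw => ⟨constant_smul_mem_negImage hw hm.1, fun g hg x => ?_⟩)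
    (fun x y hx hy => by rw [map_add, map_add, add_smul]; exact add_mem hx hy)
  refine S.homogeneous_induction
    (P := fun x => (S.affine B).envι (current g x) • (S.affine B).envι (current 1 w) • m = 0) x
    (fun b x hx => ?_)
    (fun x y hx hy => by rw [map_add, map_add, add_smul, hx, hy, add_zero])
  have hbr : (S.affine B).br (current g x) (current 1 w) = current g (S.br x w) := by
    have h : laurentRes (laurentD g) = 0 := laurentRes_D g
    rw [br_current, mul_one, mul_one, h, zero_mul]
    rfl
  rw [envι_smul_envι_smul _ (current_mem S B g hx) (current_mem S B 1 hw), hm.2 g hg, hbr,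
    hm.2 g hg, smul_zero, smul_zero, add_zero]

/-- A regular series is a constant plus a series in tℂ[[t]]; the latter kills `m`, so only the
action of g matters. -/
theorem regular_smul_mem_negSingular (z : LaurC ⊗[ℂ] L) {m : M} (hm : m ∈ negSingular S B M) :
    (S.affine B).envι (z - loopPolar L z, 0) • m ∈ negSingular S B M := by
  induction z with
  | zero =>
    rw [map_zero, sub_zero, show ((0, 0) : AffSpace L) = 0 from rfl, map_zero, zero_smul]
    exact zero_mem _
  | add x y hx hy =>
    rw [map_add, add_sub_add_comm, show ((x - loopPolar L x + (y - loopPolar L y), 0) : AffSpace L)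
      = (x - loopPolar L x, 0) + (y - loopPolar L y, 0) by simp, map_add, add_smul]
    exact add_mem hx hy
  | tmul f x =>
    obtain ⟨g, hg, e⟩ := LaurC.eq_regular_decomposition (f := f - LaurC.polar f)
      fun m hm => LaurC.coeff_sub_polar f hm
    rw [loopPolar_tmul, ← TensorProduct.sub_tmul, ← current_apply, e]
    generalize (f - LaurC.polar f).coeff 0 = c
    rw [show current (c • 1 + g) x = c • current 1 x + current g x by
      simp [current_apply, TensorProduct.add_tmul, ← TensorProduct.smul_tmul'],
      map_add, map_smul, add_smul, smul_assoc, hm.2 g hg, add_zero]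
    exact Submodule.smul_mem _ _ (constant_smul_mem_negSingular x hm)

/-- The closure of `negSingular` under `t⁻¹ g[t⁻¹] ⊕ ℂ K ⊕ ℂ T`. -/
inductive NegClosure (S : LieSuper L) (B : S.InvForm) {M : Type} [AddCommGroup M] [Module ℂ M]
    [Module (S.affine B).Env M] [IsScalarTower ℂ (S.affine B).Env M] : M → Prop
  | base (m : M) : m ∈ negSingular S B M → NegClosure S B m
  | add (m m' : M) : NegClosure S B m → NegClosure S B m' → NegClosure S B (m + m')
  | smul (c : ℂ) (m : M) : NegClosure S B m → NegClosure S B (c • m)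
  | lower (b : ZMod 2) (p : AffSpace L) (m : M) : p ∈ (S.affine B).part b →
      loopPolar L p.1 = p.1 → NegClosure S B m → NegClosure S B ((S.affine B).envι p • m)

theorem NegClosure.mem_negImage {m : M} (hm : NegClosure S B m) : m ∈ negImage S B M := by
  induction hm with
  | base m hm => exact hm.1
  | add m m' _ _ h h' => exact add_mem h h'
  | smul c m _ h => exact Submodule.smul_mem _ c h
  | lower b p m hp hp1 _ h =>
    rw [show p = (p.1, 0) + (0, p.2) by simp, map_add, add_smul]
    exact add_mem (Submodule.subset_span ⟨b, (p.1, 0), m,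
      (S.mem_affine_part B).2 ⟨((S.mem_affine_part B).1 hp).1, Or.inr rfl⟩, hp1, rfl, rfl⟩)
      (central_smul_mem_negImage p.2 h)

/-- This replaces the factorization of U(ĝ) with the factor of n_- ⊕ ℂK ⊕ ℂT on the left. In the
case `lower`, x p m = ±p x m + [x,p] m, and the induction hypothesis, valid for all elements of ĝ,
covers both x m and [x,p] m. In the case `base`, x is cut into its polar part with K and T, which is
a `lower` step, and its regular part, which preserves `negSingular`. -/
theorem NegClosure.envι_smul {m : M} (hm : NegClosure S B m) (x : AffSpace L) :
    NegClosure S B ((S.affine B).envι x • m) := by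
  induction hm generalizing x with
  | add m m' _ _ h h' => rw [smul_add]; exact .add _ _ (h x) (h' x)
  | smul c m _ h => rw [smul_smul_comm_env]; exact .smul _ _ (h x)
  | base m hm =>
    refine (S.affine B).homogeneous_induction
      (P := fun x => NegClosure S B ((S.affine B).envι x • m)) x (fun a x hx => ?_)
      (fun x y hx hy => by rw [map_add, add_smul]; exact .add _ _ hx hy)
    rw [show x = (loopPolar L x.1, x.2) + (x.1 - loopPolar L x.1, 0) by simp, map_add, add_smul]
    have hx' := (S.mem_affine_part B).1 hx
    exact .add _ _ (.lower a _ _ ((S.mem_affine_part B).2 ⟨loopPolar_mem S a hx'.1, hx'.2⟩)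
      (loopPolar_loopPolar _) (.base _ hm)) (.base _ (regular_smul_mem_negSingular x.1 hm))
  | lower b p m hp hp1 _ h =>
    refine (S.affine B).homogeneous_induction
      (P := fun x => NegClosure S B ((S.affine B).envι x • (S.affine B).envι p • m)) x
      (fun a x hx => ?_) (fun x y hx hy => by rw [map_add, add_smul]; exact .add _ _ hx hy)
    rw [envι_smul_envι_smul _ hx hp]
    exact .add _ _ (.smul _ _ (.lower b p _ hp hp1 (h x))) (h _)

theorem NegClosure.env_smul {m : M} (hm : NegClosure S B m) (u : (S.affine B).Env) :
    NegClosure S B (u • m) := by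
  refine (S.affine B).env_induction (P := fun u => NegClosure S B (u • m)) u
    (by rwa [one_smul]) (fun u v hu hv => by rw [add_smul]; exact .add _ _ hu hv)
    (fun c u hu => by rw [smul_assoc]; exact .smul _ _ hu)
    (fun x u hu => by rw [mul_smul]; exact hu.envι_smul x)

theorem smul_mem_negImage {m : M} (hm : m ∈ negSingular S B M) (u : (S.affine B).Env) :
    u • m ∈ negImage S B M :=
  ((NegClosure.base m hm).env_smul u).mem_negImage

theorem mode_mode_smul_mem_negSingular {y z : L} {b : ZMod 2} (hy : y ∈ S.part b) {v : M}
    (h : ∀ g : LaurC, (∀ i < 1, g.coeff i = 0) → ∀ x : L, (S.affine B).envι (current g x) •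
      mode S B y (-1) • mode S B z (-1) • v = 0) :
    mode S B y (-1) • mode S B z (-1) • v ∈ negSingular S B M := by
  refine ⟨Submodule.subset_span ⟨b, current (LaurC.tpow (-1)) y, _, current_mem S B _ hy, ?_, rfl,
    rfl⟩, h⟩
  -- The projection does not depend on the level, so the value 0 is arbitrary.
  exact congrArg Prod.fst (affineSplitting_p_mode S B 0 y)

end Proper

/-! ### The vacuum expectation functional. -/

section Augmentation

variable {L : Type} [AddCommGroup L] [Module ℂ L]

/-- The augmentation of the enveloping algebra of `t⁻¹ g[t⁻¹]`. -/
noncomputable def negAugmentation (S : LieSuper L) (B : S.InvForm) (k : ℂ) :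
    (affineSplitting S B k).neg.Env →ₐ[ℂ] ℂ :=
  (affineSplitting S B k).neg.envLift 0 (by simp)

/-- The vacuum expectation functional. -/
noncomputable def vacuumExpectation (S : LieSuper L) (B : S.InvForm) (k : ℂ) :
    UnivAffine S B k →ₗ[ℂ] ℂ :=
  (negAugmentation S B k).toLinearMap ∘ₗ univAffineToNeg S B k

theorem vacuumExpectation_vacuum (S : LieSuper L) (B : S.InvForm) (k : ℂ) :
    vacuumExpectation S B k (vacuum S B k) = 1 := by
  change negAugmentation S B k (univAffineToNeg S B k (vacuum S B k)) = 1
  rw [univAffineToNeg_vacuum, map_one]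

/-- In the model U(n_-), elements of n_- act by left multiplication, so the image of n_-V lies in
the augmentation ideal. -/
theorem vacuumExpectation_of_mem (S : LieSuper L) (B : S.InvForm) (k : ℂ)
    {v : UnivAffine S B k} (hv : v ∈ negImage S B (UnivAffine S B k)) :
    vacuumExpectation S B k v = 0 := by
  have h : negImage S B (UnivAffine S B k) ≤ LinearMap.ker (vacuumExpectation S B k) := by
    refine Submodule.span_le.2 ?_
    rintro _ ⟨b, p, m, -, hp1, hp2, rfl⟩
    have hp : (affineSplitting S B k).p p = p := by
      rw [affineSplitting_p, hp1, ← hp2]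
    change negAugmentation S B k (univAffineToNeg S B k _) = 0
    rw [univAffineToNeg_smul, ← hp, LieSuper.Splitting.act_p, map_mul,
      LieSuper.Splitting.rho_eq_envι, negAugmentation, LieSuper.envLift_envι,
      LinearMap.zero_apply, zero_mul]
  exact h hv

end Augmentation

theorem chi_mem_negSingular (n : ℕ) (hn : 2 ≤ n) :
    chi n hn ∈ negSingular (psl n) (pslForm n) (VPsl n) :=
  mode_mode_smul_mem_negSingular (pslE_mem _) fun _ hg x =>
    isSingularVector_chi n hn _ ⟨_, Submodule.mem_sup_right (tmul_mem_powerPart hg x), rfl⟩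

/-- The vector `χ` is singular in `V^1(psl(n|n))`, and generates a proper non-zero submodule. -/
theorem mainTheorem5 (n : ℕ) (hn : 2 ≤ n) :
    IsSingularVector (psl n) (pslForm n) 1 (pslNPlus n) (chi n hn) ∧
      chiSubmodule n hn ≠ ⊥ ∧ chiSubmodule n hn ≠ ⊤ := by
  refine ⟨isSingularVector_chi n hn, ?_, ?_⟩
  · exact fun h => chi_ne_zero n hn (Submodule.span_singleton_eq_bot.1 h)
  · intro h
    -- If the submodule were everything, the vacuum would be uχ and lie in n_-V, where the
    -- expectation is 0, yet its expectation is 1.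
    have hv : vacuum (psl n) (pslForm n) 1 ∈ chiSubmodule n hn := by rw [h]; trivial
    obtain ⟨u, hu⟩ := Submodule.mem_span_singleton.1 hv
    have h0 := vacuumExpectation_of_mem (psl n) (pslForm n) 1
      (smul_mem_negImage (chi_mem_negSingular n hn) u)
    rw [hu, vacuumExpectation_vacuum] at h0
    exact one_ne_zero h0
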